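/- Let $k$ be an algebraically closed field of characteristic $0$, and let $A$, $B$, $V$ be $k$-vector spaces of dimensions $a$, $b$ and $4$. Let $f\ge 1$ be an integer, and assume $2b\ge 5a$ and $2a>5f$. Let $\mathcal M=\mathrm{Hom}(B,A\otimes V)$, an affine space with its Zariski topology. For $m\in\mathcal M$ let $m(1):B\otimes V\to A\otimes S^2V$ be the composition of $m\otimes 1_V$ with the product $A\otimes V\otimes V\to A\otimes S^2V$, and let $Z_m=\mathrm{Im}\,m(1)$. For a subspace $Z\subset A\otimes S^2V$ with quotient $F=(A\otimes S^2V)/Z$, let $Z^*\subset A\otimes V$ be the kernel of the map $A\otimes V\to \mathrm{Hom}(V,F)=V^\vee\otimes F$ sending $x\otimes y$ to $z\mapsto (x\otimes yz \bmod Z)$. Let $\mathcal W\subset\mathcal M$ be the locus of those $m$ for which $m(1)$ has corank (the minimum of the dimensions of kernel and cokernel) at least $f$, and let $\mathcal{PW}$ be the set of $m\in\mathcal W$ such that $Z_m$ has codimension exactly $f$ in $A\otimes S^2V$ and $Z_m^*$ has codimension $4f$ in $A\otimes V$. Then: 1. $\mathcal{PW}$ is open in $\mathcal W$, nonempty, irreducible,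 and of codimension $f(4b-10a+f)$ in $\mathcal M$ (that is, $\dim\mathcal{PW}=\dim\mathcal M-f(4b-10a+f)$). 2. The generic matrix $\mu$ of $\mathcal{PW}$ is the generic morphism $B\to Z^*$, where $Z$ is the generic codimension-$f$ subspace of $A\otimes S^2V$ (for which $Z^*$ has codimension $4f$), and the image of $\mu(1)$ is $Z$. Precisely: the Grassmannian $G$ of codimension-$f$ subspaces of $A\otimes S^2V$ is irreducible, and $\operatorname{codim}Z^*=4f$ for $Z$ in a dense open subset of $G$; the variety $Q\subset G\times\mathcal M$ of the pairs $(Z,m)$ with $\operatorname{codim} Z^*=4f$ and $m(B)\subset Z^*$ is irreducible; a property of pairs $(Z,m)$ holds for all $(Z_m,m)$ with $m$ in some dense open subset of $\mathcal{PW}$ if and only if it holds on some dense open subset of $Q$; one has $\mathrm{Im}\,m(1)=Z$ for all $(Z,m)$ in a dense open subset of $Q$; and for $Z$ in a dense open subset of $G$, all $m$ in a dense open subset of $\mathrm{Hom}(B,Z^*)$ satisfy $m\in\mathcal{PW}$ and $\mathrm{Im}\,m(1)=Z$. -/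

import Mathlib

open scoped TensorProduct

noncomputable section

namespace Steiner

universe u v w

section Zariski

variable (k : Type u) [Field k] (E : Type v) [AddCommGroup E] [Module k E]

/-- The algebra of polynomial functions on a vector space `E`: the subalgebra of `E → k`
generated by the linear forms. -/
def polyFun : Subalgebra k (E → k) :=
  Algebra.adjoin k (Set.range fun φ : Module.Dual k E => (φ : E → k))

/-- The common zeros in `E` of a set of functions. -/
def zeros (S : Set (E → k)) : Set E := {x | ∀ p ∈ S, p x = 0}

/-- The Zariski topology: the closed sets are the zero loci of sets of polynomial functions. -/
abbrev zariski : TopologicalSpace E :=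
  TopologicalSpace.ofClosed
    {C : Set E | ∃ S : Set (E → k), S ⊆ (polyFun k E : Set (E → k)) ∧ C = zeros k E S}
    ⟨{1}, by
      rintro _ rfl
      exact (polyFun k E).one_mem, by
      ext x
      simp [zeros]⟩
    (by
      intro 𝒞 h𝒞
      refine ⟨{p | p ∈ polyFun k E ∧ ∃ C ∈ 𝒞, ∀ x ∈ C, p x = 0}, fun p hp => hp.1, ?_⟩
      ext x
      constructor
      · rintro hx p ⟨-, C, hC, hp⟩
        exact hp x (hx C hC)
      · intro hx C hC
        obtain ⟨S, hS, rfl⟩ := h𝒞 hC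
        exact fun p hp => hx p ⟨hS hp, _, hC, fun y hy => hy p hp⟩)
    (by
      rintro _ ⟨S, hS, rfl⟩ _ ⟨T, hT, rfl⟩
      refine ⟨{r | ∃ p ∈ S, ∃ q ∈ T, r = p * q}, ?_, ?_⟩
      · rintro _ ⟨p, hp, q, hq, rfl⟩
        exact (polyFun k E).mul_mem (hS hp) (hT hq)
      · ext x
        constructor
        · rintro (hx | hx) _ ⟨p, hp, q, hq, rfl⟩
          · simp [hx p hp]
          · simp [hx q hq]
        · intro hx
          by_contra h
          simp only [zeros, Set.mem_union, Set.mem_ofPred_eq, not_or, not_forall] at h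
          obtain ⟨⟨p, hp, hpx⟩, q, hq, hqx⟩ := h
          exact mul_ne_zero hpx hqx (hx (p * q) ⟨p, hp, q, hq, rfl⟩))

/-- Spaces of linear maps carry the Zariski topology. -/
instance homTopology (F : Type w) [AddCommGroup F] [Module k F] : TopologicalSpace (E →ₗ[k] F) :=
  zariski k (E →ₗ[k] F)

end Zariski

section Generic

variable {X : Type v} [TopologicalSpace X]

/-- The property `P` holds for the generic element of `Y`: it holds on a non-empty relatively
open subset of `Y`. Used for irreducible `Y` only, where such a subset is dense. -/
def Generically (Y : Set X) (P : X → Prop) : Prop :=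
  ∃ U : Set X, IsOpen U ∧ (Y ∩ U).Nonempty ∧ ∀ x ∈ Y ∩ U, P x

/-- `Y` has codimension `c` in the ambient space: `X` and `Y` have finite dimension, with
`dim Y + c = dim X` (Krull dimensions of topological spaces). -/
def HasCodim (Y : Set X) (c : ℕ) : Prop :=
  ∃ d n : ℕ, topologicalKrullDim Y = d ∧ topologicalKrullDim X = n ∧ d + c = n

end Generic

section Grassmannian

variable (k : Type u) [Field k] (E : Type v) [AddCommGroup E] [Module k E] (f : ℕ)
  (N : Type w) [AddCommGroup N] [Module k N]

variable {k E f} in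
/-- The kernel of a surjective linear map `E → k^f`, as a point of the Grassmannian of
codimension `f` subspaces of `E`. -/
def kerGr (g : E →ₗ[k] (Fin f → k)) (hg : Function.Surjective g) : Module.Grassmannian k E f where
  toSubmodule := LinearMap.ker g
  finite_quotient := Module.Finite.equiv (g.quotKerEquivOfSurjective hg).symm
  projective_quotient := inferInstance
  rankAtStalk_eq p := by
    have : Module.Finite k (E ⧸ LinearMap.ker g) :=
      Module.Finite.equiv (g.quotKerEquivOfSurjective hg).symm
    rw [Module.rankAtStalk_eq_finrank_of_free, Pi.natCast_apply,
      (g.quotKerEquivOfSurjective hg).finrank_eq]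
    simp

/-- The Zariski topology of the Grassmannian of codimension `f` subspaces of `E`, as the quotient
of the (open) set of surjective linear maps `E → k^f` by the action of `GL_f`. -/
instance grTopology : TopologicalSpace (Module.Grassmannian k E f) :=
  TopologicalSpace.coinduced
    (fun g : {g : E →ₗ[k] (Fin f → k) // Function.Surjective g} => kerGr g.1 g.2)
    (TopologicalSpace.induced Subtype.val (zariski k (E →ₗ[k] (Fin f → k))))

/-- The product variety of the Grassmannian of codimension `f` subspaces of `E` and of the
affine space `N`; its points are the pairs `(sub, pt)`. -/
structure GrProd where
  /-- the subspace of codimension `f` -/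
  sub : Module.Grassmannian k E f
  /-- the point of the affine space -/
  pt : N

/-- The Zariski topology of `GrProd` (finer than the product topology), as the quotient of the set
of pairs `(g, n)` with `g : E → k^f` linear and surjective, by the action of `GL_f` on `g`. -/
instance grProdTopology : TopologicalSpace (GrProd k E f N) :=
  TopologicalSpace.coinduced
    (fun p : {p : (E →ₗ[k] (Fin f → k)) × N // Function.Surjective p.1} =>
      (⟨kerGr p.1.1 p.2, p.1.2⟩ : GrProd k E f N))
    (TopologicalSpace.induced Subtype.val (zariski k ((E →ₗ[k] (Fin f → k)) × N)))

end Grassmannian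

section LinearAlgebra

variable (k : Type u) [Field k]

/-- The codimension of a subspace. -/
def codim {E : Type*} [AddCommGroup E] [Module k E] (U : Submodule k E) : ℕ :=
  Module.finrank k (E ⧸ U)

/-- The corank of a linear map: the minimum of the dimensions of its kernel and cokernel. -/
def corank {E F : Type*} [AddCommGroup E] [Module k E] [AddCommGroup F] [Module k F]
    (φ : E →ₗ[k] F) : ℕ :=
  min (Module.finrank k (LinearMap.ker φ)) (codim k (LinearMap.range φ))

/-- The symmetric square `S²V`, the quotient of `V ⊗ V` by the tensors `v ⊗ w - w ⊗ v`. -/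
abbrev SymSq (V : Type*) [AddCommGroup V] [Module k V] : Type _ :=
  (V ⊗[k] V) ⧸ Submodule.span k {t : V ⊗[k] V | ∃ v w : V, t = v ⊗ₜ[k] w - w ⊗ₜ[k] v}

variable (A B V : Type*) [AddCommGroup A] [Module k A] [AddCommGroup B] [Module k B]
  [AddCommGroup V] [Module k V]

/-- The product `(A ⊗ V) ⊗ V → A ⊗ S²V`. -/
def prodMap : (A ⊗[k] V) ⊗[k] V →ₗ[k] A ⊗[k] SymSq k V :=
  (Submodule.mkQ _).lTensor A ∘ₗ (TensorProduct.assoc k A V V).toLinearMap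

variable {k A B V}

/-- The map `m(1) : B ⊗ V → A ⊗ S²V` induced by `m : B → A ⊗ V`. -/
def one (m : B →ₗ[k] A ⊗[k] V) : B ⊗[k] V →ₗ[k] A ⊗[k] SymSq k V :=
  prodMap k A V ∘ₗ m.rTensor V

/-- The subspace `Z_m = Im m(1)`. -/
def Zof (m : B →ₗ[k] A ⊗[k] V) : Submodule k (A ⊗[k] SymSq k V) :=
  LinearMap.range (one m)

/-- For a linear map `g : A ⊗ S²V → F`, the map `g* : A ⊗ V → Hom(V, F) = V^∨ ⊗ F` with
`g*(x ⊗ y)(z) = g(x ⊗ yz)`. -/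
def formStar {F : Type*} [AddCommGroup F] [Module k F] (g : A ⊗[k] SymSq k V →ₗ[k] F) :
    A ⊗[k] V →ₗ[k] (V →ₗ[k] F) :=
  TensorProduct.curry (g ∘ₗ prodMap k A V)

/-- For `Z ⊆ A ⊗ S²V` with quotient `F`, the kernel `Z*` of the map `A ⊗ V → Hom(V, F)` attached
to the projection `A ⊗ S²V → F`. -/
def Zstar (Z : Submodule k (A ⊗[k] SymSq k V)) : Submodule k (A ⊗[k] V) :=
  LinearMap.ker (formStar Z.mkQ)

variable (k A B V) (f : ℕ)

/-- The locus `𝒲` of the `m` such that `m(1)` has corank at least `f`. -/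
def locusW : Set (B →ₗ[k] A ⊗[k] V) :=
  {m | f ≤ corank k (one m)}

/-- The locus `𝒫𝒲` of the `m` in `𝒲` such that `Z_m` has codimension exactly `f` and `Z_m*` has
codimension `4f`. -/
def locusPW : Set (B →ₗ[k] A ⊗[k] V) :=
  {m | m ∈ locusW k A B V f ∧ codim k (Zof m) = f ∧
    codim k (Zstar (Zof m)) = 4 * f}

variable {k A V} in
/-- The space `Hom(B, Z*)`, as a subset of `Hom(B, A ⊗ V)`. -/
def homStar (Z : Submodule k (A ⊗[k] SymSq k V)) : Set (B →ₗ[k] A ⊗[k] V) :=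
  {m | LinearMap.range m ≤ Zstar Z}

/-- The variety of the pairs `(Z, m)` where `Z` is a codimension `f` subspace of `A ⊗ S²V` such
that `Z*` has codimension `4f`, and `m` is a morphism from `B` to `Z*`. -/
def locusQ : Set (GrProd k (A ⊗[k] SymSq k V) f (B →ₗ[k] A ⊗[k] V)) :=
  {p | codim k (Zstar p.sub.toSubmodule) = 4 * f ∧ p.pt ∈ homStar B p.sub.toSubmodule}

end LinearAlgebra

end Steiner

end

/-!
For a surjection `g : A ⊗ S²V → kᶠ` with kernel `Z`, the space `Z*` is the kernel of the induced map
`g* : A ⊗ V → Hom(V, kᶠ)`, it has codimension `4f` exactly when `g*` is surjective, and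
`m(B) ⊆ Z*` is equivalent both to `g* ∘ m = 0` and to `Im m(1) ⊆ Z`.

Hence `Q` is a quotient of the family of the kernels of `m ↦ g* ∘ m`, where `g` runs over the forms
with `g*` surjective. Such a family is irreducible: over an infinite field any two of the `ker g*`
have a common complement, and the projections to the `ker g*` along it map an open subset of a
vector space onto an irreducible part of the family containing two given points. On `Q` the
condition `Im m(1) = Z` is open, as it says that `m(1)` has maximal rank, and `𝒫𝒲` is the projection
of the open subset it defines.

Near a point of `𝒫𝒲` there is a form `γ m`, depending regularly on `m`, with `ker (γ m) ⊆ Im m(1)`.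
It shows that `𝒫𝒲` is open in `𝒲`, that open subsets of `Q` and `𝒫𝒲` correspond, and that `𝒫𝒲` is
locally homeomorphic to an open subset of an affine space whose dimension can be read off.

To find a point of `𝒫𝒲`, take direct sums: they reduce the general `a`, `b`, `f` to five triples,
for which there are explicit vectors and forms with coefficients `0` and `±1`.
-/

noncomputable section

namespace Steiner

section Regular

variable {k : Type*} [Field k]
variable {E : Type*} [AddCommGroup E] [Module k E]
variable {F : Type*} [AddCommGroup F] [Module k F]
variable {G : Type*} [AddCommGroup G] [Module k G]
variable {H : Type*} [AddCommGroup H] [Module k H]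

variable (k) in
/-- The topology of the vector space `E` is the Zariski topology. -/
class ZariskiSpace (E : Type*) [AddCommGroup E] [Module k E] [t : TopologicalSpace E] : Prop where
  eq_zariski : t = zariski k E

instance zariskiSpace_hom : ZariskiSpace k (E →ₗ[k] F) := ⟨rfl⟩

theorem isClosed_iff_exists_zeros [t : TopologicalSpace E] [h : ZariskiSpace k E] {C : Set E} :
    IsClosed C ↔ ∃ S : Set (E → k), S ⊆ (polyFun k E : Set (E → k)) ∧ C = zeros k E S := by
  obtain rfl := h.eq_zariski
  rw [← @isOpen_compl_iff _ _ (zariski k E)]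
  change Cᶜᶜ ∈ _ ↔ _
  rw [compl_compl]
  rfl

theorem dual_mem_polyFun (φ : Module.Dual k E) : (φ : E → k) ∈ polyFun k E :=
  Algebra.subset_adjoin ⟨φ, rfl⟩

theorem isOpen_setOf_ne_zero [TopologicalSpace E] [ZariskiSpace k E] {p : E → k}
    (hp : p ∈ polyFun k E) : IsOpen {x | p x ≠ 0} := by
  rw [← isClosed_compl_iff, isClosed_iff_exists_zeros (k := k)]
  refine ⟨{p}, by simpa using hp, ?_⟩
  ext x
  simp [zeros]

theorem exists_polyFun_ne_zero_of_isOpen [TopologicalSpace E] [ZariskiSpace k E] {U : Set E}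
    (hU : IsOpen U) {x : E} (hx : x ∈ U) :
    ∃ p ∈ polyFun k E, p x ≠ 0 ∧ ∀ y, p y ≠ 0 → y ∈ U := by
  obtain ⟨S, hS, hUS⟩ := (isClosed_iff_exists_zeros (k := k)).1 hU.isClosed_compl
  have hxS : x ∉ zeros k E S := hUS ▸ not_not_intro hx
  simp only [zeros, Set.mem_ofPred_eq, not_forall] at hxS
  obtain ⟨p, hp, hpx⟩ := hxS
  refine ⟨p, hS hp, hpx, fun y hy => ?_⟩
  by_contra hyU
  have hyS : y ∈ zeros k E S := hUS ▸ hyU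
  exact hy (hyS p hp)

/-- The algebra of the functions that are regular on `X`: those that agree on `X` with a quotient
of polynomial functions whose denominator has no zero in `X`. A single quotient is required on all
of `X`, and the values outside of `X` are arbitrary. -/
def regFun (X : Set E) : Subalgebra k (E → k) where
  carrier := {r | ∃ p ∈ polyFun k E, ∃ q ∈ polyFun k E, ∀ x ∈ X, q x ≠ 0 ∧ r x = p x / q x}
  mul_mem' := by
    rintro r r' ⟨p, hp, q, hq, h⟩ ⟨p', hp', q', hq', h'⟩
    refine ⟨p * p', mul_mem hp hp', q * q', mul_mem hq hq', fun x hx => ⟨?_, ?_⟩⟩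
    · exact mul_ne_zero (h x hx).1 (h' x hx).1
    · simp [(h x hx).2, (h' x hx).2, div_mul_div_comm]
  add_mem' := by
    rintro r r' ⟨p, hp, q, hq, h⟩ ⟨p', hp', q', hq', h'⟩
    refine ⟨p * q' + q * p', add_mem (mul_mem hp hq') (mul_mem hq hp'), q * q', mul_mem hq hq',
      fun x hx => ⟨mul_ne_zero (h x hx).1 (h' x hx).1, ?_⟩⟩
    simp [(h x hx).2, (h' x hx).2, div_add_div _ _ (h x hx).1 (h' x hx).1]
  algebraMap_mem' c :=
    ⟨algebraMap k _ c, Subalgebra.algebraMap_mem _ c, 1, one_mem _, fun x _ => by simp⟩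

theorem polyFun_le_regFun (X : Set E) : polyFun k E ≤ regFun X :=
  fun p hp => ⟨p, hp, 1, one_mem _, fun x _ => by simp⟩

theorem regFun_anti {X Y : Set E} (h : X ⊆ Y) : regFun (k := k) Y ≤ regFun X := by
  rintro r ⟨p, hp, q, hq, hr⟩
  exact ⟨p, hp, q, hq, fun x hx => hr x (h hx)⟩

theorem mem_regFun_of_eqOn {X : Set E} {r r' : E → k} (hr : r ∈ regFun X) (h : X.EqOn r' r) :
    r' ∈ regFun X := by
  obtain ⟨p, hp, q, hq, hpq⟩ := hr
  exact ⟨p, hp, q, hq, fun x hx => ⟨(hpq x hx).1, (h hx).trans (hpq x hx).2⟩⟩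

theorem inv_mem_regFun {X : Set E} {r : E → k} (hr : r ∈ regFun X) (h0 : ∀ x ∈ X, r x ≠ 0) :
    r⁻¹ ∈ regFun X := by
  obtain ⟨p, hp, q, hq, h⟩ := hr
  refine ⟨q, hq, p, hp, fun x hx => ⟨fun hpx => h0 x hx ?_, ?_⟩⟩
  · rw [(h x hx).2, hpx, zero_div]
  · simp [(h x hx).2]

theorem isOpen_inter_ne_zero_of_mem_regFun [TopologicalSpace E] [ZariskiSpace k E] {U : Set E}
    (hU : IsOpen U) {r : E → k} (hr : r ∈ regFun U) : IsOpen (U ∩ {x | r x ≠ 0}) := by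
  obtain ⟨p, hp, q, -, h⟩ := hr
  have hpr : U ∩ {x | r x ≠ 0} = U ∩ {x | p x ≠ 0} :=
    Set.ext fun x => and_congr_right fun hx => by simp [(h x hx).2, (h x hx).1]
  rw [hpr]
  exact hU.inter (isOpen_setOf_ne_zero hp)

variable (k) in
/-- A map between vector spaces is regular on `X` if its composition with every linear form is. -/
def RegularOn (f : E → F) (X : Set E) : Prop :=
  ∀ φ : Module.Dual k F, (fun x => φ (f x)) ∈ regFun X

namespace RegularOn

variable {X Y : Set E} {f f' : E → F} {g : E → G}

theorem mono (hf : RegularOn k f Y) (h : X ⊆ Y) : RegularOn k f X :=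
  fun φ => regFun_anti h (hf φ)

theorem const (c : F) (X : Set E) : RegularOn k (fun _ => c) X :=
  fun φ => Subalgebra.algebraMap_mem (regFun X) (φ c)

theorem linear (T : E →ₗ[k] F) (X : Set E) : RegularOn k (fun x => T x) X :=
  fun φ => polyFun_le_regFun X (dual_mem_polyFun (φ ∘ₗ T))

theorem map (hf : RegularOn k f X) (T : F →ₗ[k] G) : RegularOn k (fun x => T (f x)) X :=
  fun φ => hf (φ ∘ₗ T)

theorem add (hf : RegularOn k f X) (hf' : RegularOn k f' X) :
    RegularOn k (fun x => f x + f' x) X := fun φ => by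
  simp only [map_add]
  exact add_mem (hf φ) (hf' φ)

theorem sub (hf : RegularOn k f X) (hf' : RegularOn k f' X) :
    RegularOn k (fun x => f x - f' x) X := fun φ => by
  simp only [map_sub]
  exact sub_mem (hf φ) (hf' φ)

theorem prodMk (hf : RegularOn k f X) (hg : RegularOn k g X) :
    RegularOn k (fun x => (f x, g x)) X := fun φ =>
  mem_regFun_of_eqOn
    (add_mem (hf (φ ∘ₗ LinearMap.inl k F G)) (hg (φ ∘ₗ LinearMap.inr k F G)))
    fun x _ => by simp [← map_add]

theorem of_forall_basis {ι : Type*} [Finite ι] (b : Module.Basis ι k F)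
    (h : ∀ i, (fun x => b.repr (f x) i) ∈ regFun X) : RegularOn k f X := fun φ => by
  have := Fintype.ofFinite ι
  have hφ : (fun x => φ (f x)) = ∑ i, φ (b i) • fun x => b.repr (f x) i := by
    ext x
    conv_lhs => rw [← b.sum_repr (f x)]
    simp [-Module.Basis.sum_repr, mul_comm]
  rw [hφ]
  exact sum_mem fun i _ => Subalgebra.smul_mem _ (h i) _

theorem bilin [FiniteDimensional k F] (β : F →ₗ[k] G →ₗ[k] H) (hf : RegularOn k f X)
    (hg : RegularOn k g X) : RegularOn k (fun x => β (f x) (g x)) X := fun φ => by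
  let b := Module.finBasis k F
  have hφ : (fun x => φ (β (f x) (g x))) =
      ∑ i, (fun x => b.coord i (f x)) * fun x => (φ ∘ₗ β (b i)) (g x) := by
    ext x
    conv_lhs => rw [← b.sum_repr (f x)]
    simp [-Module.Basis.sum_repr]
  rw [hφ]
  exact sum_mem fun i _ => mul_mem (hf _) (hg _)

theorem polyFun_comp (hf : RegularOn k f X) {p : F → k} (hp : p ∈ polyFun k F) :
    (fun x => p (f x)) ∈ regFun X := by
  induction hp using Algebra.adjoin_induction with
  | mem p hp =>
    obtain ⟨φ, rfl⟩ := hp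
    exact hf φ
  | algebraMap c => exact Subalgebra.algebraMap_mem (regFun X) c
  | add p q _ _ hp hq => exact add_mem hp hq
  | mul p q _ _ hp hq => exact mul_mem hp hq

theorem comp {Y : Set F} {h : F → G} (hh : RegularOn k h Y) (hf : RegularOn k f X)
    (hXY : Set.MapsTo f X Y) : RegularOn k (fun x => h (f x)) X := fun φ => by
  obtain ⟨p, hp, q, hq, hpq⟩ := hh φ
  refine mem_regFun_of_eqOn (mul_mem (hf.polyFun_comp hp)
    (inv_mem_regFun (hf.polyFun_comp hq) fun x hx => (hpq _ (hXY hx)).1)) fun x hx => ?_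
  simp [(hpq _ (hXY hx)).2, div_eq_mul_inv]

theorem continuousOn [TopologicalSpace E] [ZariskiSpace k E] [TopologicalSpace F]
    [ZariskiSpace k F] (hf : RegularOn k f X) : ContinuousOn f X := by
  rw [continuousOn_iff]
  intro x hx U hU hxU
  obtain ⟨p, hp, hpx, hpU⟩ := exists_polyFun_ne_zero_of_isOpen (k := k) hU hxU
  obtain ⟨r, hr, q, -, h⟩ := hf.polyFun_comp hp
  beta_reduce at h
  refine ⟨{y | r y ≠ 0}, isOpen_setOf_ne_zero hr, fun hrx => hpx ?_, ?_⟩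
  · rw [(h x hx).2, hrx, zero_div]
  · rintro y ⟨hy, hyX⟩
    refine hpU _ ?_
    rw [(h y hyX).2]
    exact div_ne_zero hy (h y hyX).1

end RegularOn

section Inverse

variable {X : Set E} {L : E → Module.End k G}

/-- Evaluation of regular functions at a point. -/
def regFunEval (X : Set E) (x : E) : regFun (k := k) X →+* k :=
  (Pi.evalRingHom (fun _ : E => k) x).comp (regFun X).val.toRingHom

theorem regFunEval_apply (x : E) (r : regFun (k := k) X) : regFunEval X x r = (r : E → k) x := rfl

theorem RegularOn.exists_matrix {ι : Type*} [Fintype ι] [DecidableEq ι] (b : Module.Basis ι k G)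
    (hL : RegularOn k L X) :
    ∃ M : Matrix ι ι (regFun (k := k) X),
      ∀ x, (regFunEval X x).mapMatrix M = LinearMap.toMatrix b b (L x) :=
  ⟨fun i j => ⟨fun x => b.coord i (L x (b j)), hL (b.coord i ∘ₗ LinearMap.applyₗ (b j))⟩,
    fun x => by ext i j; rw [LinearMap.toMatrix_apply]; rfl⟩

theorem RegularOn.det_mem_regFun [FiniteDimensional k G] (hL : RegularOn k L X) :
    (fun x => LinearMap.det (L x)) ∈ regFun X := by
  let b := Module.finBasis k G
  obtain ⟨M, hM⟩ := hL.exists_matrix b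
  refine mem_regFun_of_eqOn M.det.2 fun x _ => ?_
  rw [← LinearMap.det_toMatrix b, ← hM, ← RingHom.map_det, regFunEval_apply]

theorem toMatrix_ringInverse {ι : Type*} [Fintype ι] [DecidableEq ι] (b : Module.Basis ι k G)
    {T : Module.End k G} (hT : IsUnit T) :
    LinearMap.toMatrix b b (Ring.inverse T) =
      (LinearMap.det T)⁻¹ • (LinearMap.toMatrix b b T).adjugate := by
  rw [← LinearMap.det_toMatrix b, ← Ring.inverse_eq_inv', ← Matrix.inv_def]
  refine (Matrix.inv_eq_right_inv ?_).symm
  rw [← LinearMap.toMatrix_mul, Ring.mul_inverse_cancel _ hT, LinearMap.toMatrix_one]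

theorem RegularOn.ringInverse [FiniteDimensional k G] (hL : RegularOn k L X)
    (hX : ∀ x ∈ X, IsUnit (L x)) : RegularOn k (fun x => Ring.inverse (L x)) X := by
  let b := Module.finBasis k G
  obtain ⟨M, hM⟩ := hL.exists_matrix b
  refine RegularOn.of_forall_basis (b.linearMap b) fun ij => ?_
  have hdet : ∀ x ∈ X, LinearMap.det (L x) ≠ 0 := fun x hx =>
    (LinearMap.isUnit_det _ (hX x hx)).ne_zero
  refine mem_regFun_of_eqOn
    (mul_mem (inv_mem_regFun hL.det_mem_regFun hdet) (M.adjugate ij.1 ij.2).2) fun x hx => ?_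
  change LinearMap.toMatrix b b (Ring.inverse (L x)) ij.1 ij.2 = _
  rw [toMatrix_ringInverse b (hX x hx), ← hM, ← RingHom.map_adjugate]
  rfl

end Inverse

section Rank

variable {r : ℕ}

theorem exists_comp_comp_eq_id_of_le_finrank_range (T : F →ₗ[k] G)
    (h : r ≤ Module.finrank k (LinearMap.range T)) :
    ∃ (p : G →ₗ[k] (Fin r → k)) (c : (Fin r → k) →ₗ[k] F), p ∘ₗ T ∘ₗ c = LinearMap.id := by
  obtain ⟨v, hv⟩ := exists_linearIndependent_of_le_finrank (R := k) h
  choose w hw using fun i => (v i).2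
  have hTw : LinearIndependent k (T ∘ w) := by
    rw [show T ∘ w = (LinearMap.range T).subtype ∘ v from funext hw]
    exact hv.map' _ (Submodule.ker_subtype _)
  have hinj : LinearMap.ker (T ∘ₗ Fintype.linearCombination k w) = ⊥ := by
    rw [LinearMap.ker_eq_bot']
    intro x hx
    refine funext (Fintype.linearIndependent_iff.1 hTw x ?_)
    simpa [Fintype.linearCombination_apply] using hx
  obtain ⟨p, hp⟩ := (T ∘ₗ Fintype.linearCombination k w).exists_leftInverse_of_injective hinj
  exact ⟨p, _, hp⟩

theorem le_finrank_range_of_isUnit [FiniteDimensional k G] (T : F →ₗ[k] G)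
    (p : G →ₗ[k] (Fin r → k)) (c : (Fin r → k) →ₗ[k] F)
    (h : IsUnit (p ∘ₗ T ∘ₗ c : Module.End k (Fin r → k))) :
    r ≤ Module.finrank k (LinearMap.range T) := by
  have hmap : (LinearMap.range T).map p = ⊤ := by
    rw [eq_top_iff, ← LinearMap.range_eq_top.2 ((Module.End.isUnit_iff _).1 h).2]
    rintro _ ⟨x, rfl⟩
    exact ⟨T (c x), ⟨_, rfl⟩, rfl⟩
  have hle := Submodule.finrank_map_le p (LinearMap.range T)
  rwa [hmap, finrank_top, Module.finrank_fin_fun] at hle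

theorem surjective_iff_finrank_le_finrank_range [FiniteDimensional k G] (T : F →ₗ[k] G) :
    Function.Surjective T ↔ Module.finrank k G ≤ Module.finrank k (LinearMap.range T) := by
  rw [← LinearMap.range_eq_top]
  refine ⟨fun h => by rw [h, finrank_top], fun h => ?_⟩
  exact Submodule.eq_top_of_finrank_eq (le_antisymm (Submodule.finrank_le _) h)

end Rank

section Open

variable [TopologicalSpace E] [ZariskiSpace k E] {U : Set E}

theorem RegularOn.isOpen_inter_isUnit [FiniteDimensional k G] {L : E → Module.End k G}
    (hL : RegularOn k L U) (hU : IsOpen U) : IsOpen (U ∩ {x | IsUnit (L x)}) := by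
  simpa only [LinearMap.isUnit_iff_isUnit_det, isUnit_iff_ne_zero] using
    isOpen_inter_ne_zero_of_mem_regFun hU hL.det_mem_regFun

theorem RegularOn.isOpen_inter_le_finrank_range [FiniteDimensional k G]
    {T : E → F →ₗ[k] G} (hT : RegularOn k T U) (hU : IsOpen U) (r : ℕ) :
    IsOpen (U ∩ {x | r ≤ Module.finrank k (LinearMap.range (T x))}) := by
  rw [isOpen_iff_forall_mem_open]
  rintro x ⟨hxU, hx⟩
  obtain ⟨p, c, hpc⟩ := exists_comp_comp_eq_id_of_le_finrank_range (T x) hx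
  refine ⟨U ∩ {y | IsUnit (p ∘ₗ T y ∘ₗ c : Module.End k (Fin r → k))},
    fun y hy => ⟨hy.1, le_finrank_range_of_isUnit (T y) p c hy.2⟩, ?_, hxU, ?_⟩
  · exact (hT.map (LinearMap.compRight k p ∘ₗ LinearMap.lcomp k G c)).isOpen_inter_isUnit hU
  · rw [Set.mem_ofPred_eq, hpc]
    exact isUnit_one

theorem RegularOn.isOpen_inter_surjective [FiniteDimensional k G]
    {T : E → F →ₗ[k] G} (hT : RegularOn k T U) (hU : IsOpen U) :
    IsOpen (U ∩ {x | Function.Surjective (T x)}) := by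
  simpa only [surjective_iff_finrank_le_finrank_range] using hT.isOpen_inter_le_finrank_range hU _

end Open

end Regular

section Irreducible

variable {k : Type*} [Field k]
variable {E : Type*} [AddCommGroup E] [Module k E]

theorem exists_polynomial_eval_eq_comp_lineMap {p : E → k} (hp : p ∈ polyFun k E) (x y : E) :
    ∃ P : Polynomial k, ∀ t, P.eval t = p (AffineMap.lineMap x y t) := by
  induction hp using Algebra.adjoin_induction with
  | mem p hp =>
    obtain ⟨φ, rfl⟩ := hp
    refine ⟨Polynomial.X * Polynomial.C (φ (y - x)) + Polynomial.C (φ x), fun t => ?_⟩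
    simp [AffineMap.lineMap_apply]
  | algebraMap c => exact ⟨Polynomial.C c, fun t => by simp⟩
  | add p q _ _ hp hq =>
    obtain ⟨P, hP⟩ := hp
    obtain ⟨Q, hQ⟩ := hq
    exact ⟨P + Q, fun t => by simp [hP, hQ]⟩
  | mul p q _ _ hp hq =>
    obtain ⟨P, hP⟩ := hp
    obtain ⟨Q, hQ⟩ := hq
    exact ⟨P * Q, fun t => by simp [hP, hQ]⟩

theorem exists_lineMap_mem_and_mem [Infinite k] [TopologicalSpace E] [ZariskiSpace k E]
    {U W : Set E} (hU : IsOpen U) (hW : IsOpen W) {x y : E} (hx : x ∈ U) (hy : y ∈ W) :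
    ∃ t : k, AffineMap.lineMap x y t ∈ U ∧ AffineMap.lineMap x y t ∈ W := by
  obtain ⟨p, hp, hpx, hpU⟩ := exists_polyFun_ne_zero_of_isOpen (k := k) hU hx
  obtain ⟨q, hq, hqy, hqW⟩ := exists_polyFun_ne_zero_of_isOpen (k := k) hW hy
  obtain ⟨P, hP⟩ := exists_polynomial_eval_eq_comp_lineMap hp x y
  obtain ⟨Q, hQ⟩ := exists_polynomial_eval_eq_comp_lineMap hq x y
  have hP0 : P ≠ 0 := by
    rintro rfl
    exact hpx (by simpa using (hP 0).symm)
  have hQ0 : Q ≠ 0 := by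
    rintro rfl
    exact hqy (by simpa using (hQ 1).symm)
  obtain ⟨t, ht⟩ : ∃ t, (P * Q).eval t ≠ 0 := by
    by_contra! h
    exact mul_ne_zero hP0 hQ0 (Polynomial.funext fun t => by rw [h, Polynomial.eval_zero])
  rw [Polynomial.eval_mul] at ht
  exact ⟨t, hpU _ (hP t ▸ left_ne_zero_of_mul ht), hqW _ (hQ t ▸ right_ne_zero_of_mul ht)⟩

theorem isPreirreducible_affineSubspace [Infinite k] [TopologicalSpace E] [ZariskiSpace k E]
    (S : AffineSubspace k E) : IsPreirreducible (S : Set E) := by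
  rintro U W hU hW ⟨x, hxS, hx⟩ ⟨y, hyS, hy⟩
  obtain ⟨t, ht⟩ := exists_lineMap_mem_and_mem (k := k) hU hW hx hy
  exact ⟨_, AffineMap.lineMap_mem t hxS hyS, ht⟩

theorem isPreirreducible_inter_of_isOpen {X : Type*} [TopologicalSpace X] {S U : Set X}
    (hS : IsPreirreducible S) (hU : IsOpen U) : IsPreirreducible (S ∩ U) := by
  rintro V W hV hW ⟨x, ⟨hxS, hxU⟩, hx⟩ ⟨y, ⟨hyS, hyU⟩, hy⟩
  obtain ⟨z, hzS, ⟨hzU, hzV⟩, -, hzW⟩ := hS (U ∩ V) (U ∩ W) (hU.inter hV) (hU.inter hW)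
    ⟨x, hxS, hxU, hx⟩ ⟨y, hyS, hyU, hy⟩
  exact ⟨z, ⟨hzS, hzU⟩, hzV, hzW⟩

variable (k) in
theorem isPreirreducible_of_isOpen [Infinite k] [TopologicalSpace E] [ZariskiSpace k E]
    {U : Set E} (hU : IsOpen U) : IsPreirreducible U := by
  simpa using isPreirreducible_inter_of_isOpen (isPreirreducible_affineSubspace (k := k) ⊤) hU

theorem isPreirreducible_of_forall_pair {X : Type*} [TopologicalSpace X] {S : Set X}
    (h : ∀ x ∈ S, ∀ y ∈ S, ∃ T ⊆ S, IsPreirreducible T ∧ x ∈ T ∧ y ∈ T) :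
    IsPreirreducible S := by
  rintro U W hU hW ⟨x, hxS, hx⟩ ⟨y, hyS, hy⟩
  obtain ⟨T, hTS, hT, hxT, hyT⟩ := h x hxS y hyS
  obtain ⟨z, hzT, hz⟩ := hT U W hU hW ⟨x, hxT, hx⟩ ⟨y, hyT, hy⟩
  exact ⟨z, hTS hzT, hz⟩

end Irreducible

section Dimension

open TopologicalSpace (IrreducibleCloseds)

theorem topologicalKrullDim_le_of_forall_mem_open {X : Type*} [TopologicalSpace X] {d : ℕ}
    (h : ∀ x : X, ∃ U : Set X, IsOpen U ∧ x ∈ U ∧ topologicalKrullDim U ≤ d) :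
    topologicalKrullDim X ≤ d := by
  rw [topologicalKrullDim, Order.krullDim_eq_iSup_coheight]
  refine iSup_le fun Z => ?_
  obtain ⟨x, hx⟩ := Z.isIrreducible.nonempty
  obtain ⟨U, hU, hxU, hd⟩ := h x
  have he := hU.isOpenEmbedding_subtypeVal
  obtain ⟨Z', hZ'⟩ := (IrreducibleCloseds.orderIsoOfIsOpenEmbedding _ he).surjective
    ⟨Z, ⟨⟨x, hxU⟩, hx⟩⟩
  obtain rfl : IrreducibleCloseds.map _ he.continuous Z' = Z := congrArg Subtype.val hZ'
  rw [he.coheight_map]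
  exact (Order.coheight_le_krullDim Z').trans hd

variable {k : Type*} [Field k] {E : Type*} [AddCommGroup E] [Module k E]

variable (k E) in
theorem ringKrullDim_polyFun_le [FiniteDimensional k E] :
    ringKrullDim (polyFun k E) ≤ Module.finrank k E := by
  let b := Module.finBasis k E
  let φ : MvPolynomial (Fin (Module.finrank k E)) k →ₐ[k] polyFun k E :=
    MvPolynomial.aeval fun i => ⟨b.coord i, dual_mem_polyFun _⟩
  have hrange : polyFun k E ≤ ((polyFun k E).val.comp φ).range := by
    refine Algebra.adjoin_le ?_
    rintro _ ⟨ψ, rfl⟩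
    refine ⟨∑ i, MvPolynomial.C (ψ (b i)) * MvPolynomial.X i, ?_⟩
    ext x
    conv_rhs => rw [← b.sum_repr x]
    simp [-Module.Basis.sum_repr, φ, Algebra.algebraMap_eq_smul_one,
      ← MvPolynomial.algebraMap_eq, mul_comm]
  have hφ : Function.Surjective φ := fun ⟨p, hp⟩ =>
    (hrange hp).imp fun P hP => Subtype.ext hP
  have hle := ringKrullDim_le_of_surjective φ.toRingHom hφ
  rw [MvPolynomial.ringKrullDim_of_isNoetherianRing] at hle
  simpa using hle

variable (k) in
/-- The ideal of the polynomial functions that vanish on `S`. -/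
def vanishingIdeal (S : Set E) : Ideal (polyFun k E) where
  carrier := {p | ∀ x ∈ S, (p : E → k) x = 0}
  add_mem' hp hq x hx := by simp [hp x hx, hq x hx]
  zero_mem' _ _ := rfl
  smul_mem' c p hp x hx := by simp [hp x hx]

theorem vanishingIdeal_anti {S T : Set E} (h : S ⊆ T) : vanishingIdeal k T ≤ vanishingIdeal k S :=
  fun _ hp x hx => hp x (h hx)

variable [TopologicalSpace E] [ZariskiSpace k E]

theorem isPrime_vanishingIdeal {S : Set E} (hS : IsIrreducible S) :
    (vanishingIdeal k S).IsPrime := by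
  have exists_ne_zero {p : polyFun k E} (hp : p ∉ vanishingIdeal k S) :
      (S ∩ {x | (p : E → k) x ≠ 0}).Nonempty := by
    by_contra h
    exact hp fun x hx => not_not.1 fun hpx => h ⟨x, hx, hpx⟩
  refine ⟨?_, fun {p q} hpq => ?_⟩
  · rw [Ne, Ideal.eq_top_iff_one]
    obtain ⟨x, hx⟩ := hS.nonempty
    exact fun h => one_ne_zero (h x hx)
  · by_contra! h
    obtain ⟨z, hz, hpz, hqz⟩ := hS.isPreirreducible _ _ (isOpen_setOf_ne_zero p.2)
      (isOpen_setOf_ne_zero q.2) (exists_ne_zero h.1) (exists_ne_zero h.2)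
    exact mul_ne_zero hpz hqz (hpq z hz)

variable (k) in
theorem mem_iff_forall_mem_vanishingIdeal {C : Set E} (hC : IsClosed C) {x : E} :
    x ∈ C ↔ ∀ p ∈ vanishingIdeal k C, (p : E → k) x = 0 := by
  obtain ⟨S, hS, rfl⟩ := (isClosed_iff_exists_zeros (k := k)).1 hC
  exact ⟨fun hx p hp => hp x hx, fun hx p hp => hx ⟨p, hS hp⟩ fun y hy => hy p hp⟩

variable (k E) in
theorem topologicalKrullDim_le_finrank [FiniteDimensional k E] :
    topologicalKrullDim E ≤ Module.finrank k E := by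
  refine le_trans ?_ (ringKrullDim_polyFun_le k E)
  rw [topologicalKrullDim, ← Order.krullDim_orderDual]
  let I (Z : IrreducibleCloseds E) : PrimeSpectrum (polyFun k E) :=
    ⟨vanishingIdeal k Z, isPrime_vanishingIdeal Z.isIrreducible⟩
  have hanti : Antitone I := fun _ _ h => vanishingIdeal_anti h
  have hinj : Function.Injective I := fun Z Z' h => by
    have hI : vanishingIdeal k (Z : Set E) = vanishingIdeal k Z' :=
      congrArg PrimeSpectrum.asIdeal h
    ext x
    rw [mem_iff_forall_mem_vanishingIdeal k Z.isClosed, hI,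
      ← mem_iff_forall_mem_vanishingIdeal k Z'.isClosed]
  exact Order.krullDim_le_of_strictMono _ (hanti.strictAnti_of_injective hinj).dual_left

theorem isClosed_affineSubspace [FiniteDimensional k E] (S : AffineSubspace k E) :
    IsClosed (S : Set E) := by
  obtain rfl | ⟨x, hx⟩ := S.eq_bot_or_nonempty
  · simp
  rw [isClosed_iff_exists_zeros (k := k)]
  refine ⟨{p | p ∈ polyFun k E ∧ ∀ y ∈ S, p y = 0}, fun p hp => hp.1, ?_⟩
  refine Set.Subset.antisymm (fun y hy p hp => hp.2 y hy) fun y hy => ?_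
  by_contra hyS
  rw [SetLike.mem_coe, ← AffineSubspace.vsub_right_mem_direction_iff_mem hx] at hyS
  obtain ⟨φ, hφ, hdir⟩ := S.direction.exists_dual_map_eq_bot_of_notMem hyS inferInstance
  have hpoly : (fun z => φ z - φ x) ∈ polyFun k E :=
    sub_mem (dual_mem_polyFun φ) (Subalgebra.algebraMap_mem (polyFun k E) (φ x))
  refine hφ ?_
  rw [vsub_eq_sub, map_sub]
  refine hy _ ⟨hpoly, fun z hz => ?_⟩
  rw [← map_sub, ← Submodule.mem_bot k, ← hdir]
  exact ⟨_, AffineSubspace.vsub_mem_direction hz hx, rfl⟩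

variable [Infinite k] [FiniteDimensional k E]

/-- The trace on the open set `U` of the affine subspace through `x ∈ U` with direction `L`. -/
def irreducibleClosedsOfDirection {U : Set E} (hU : IsOpen U) {x : E} (hx : x ∈ U)
    (L : Submodule k E) : IrreducibleCloseds U where
  carrier := Subtype.val ⁻¹' (AffineSubspace.mk' x L : Set E)
  isIrreducible' := ⟨⟨⟨x, hx⟩, AffineSubspace.self_mem_mk' x L⟩,
    (isPreirreducible_affineSubspace _).preimage hU.isOpenEmbedding_subtypeVal⟩
  isClosed' := (isClosed_affineSubspace (k := k) _).preimage continuous_subtype_val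

theorem irreducibleClosedsOfDirection_strictMono {U : Set E} (hU : IsOpen U) {x : E} (hx : x ∈ U) :
    StrictMono (irreducibleClosedsOfDirection (k := k) hU hx) := by
  refine fun L L' h => lt_of_le_not_ge (fun y hy => h.le hy) fun hle => ?_
  obtain ⟨v, hv, hvL⟩ := SetLike.exists_of_lt h
  obtain ⟨t, htU, htL⟩ := exists_lineMap_mem_and_mem (k := k) hU
    (isClosed_affineSubspace (AffineSubspace.mk' x L)).isOpen_compl (y := v + x) hx
    (by simpa using hvL)
  refine htL (@hle ⟨_, htU⟩ ?_)
  exact AffineMap.lineMap_mem t (AffineSubspace.self_mem_mk' x L') (by simpa using hv)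

variable (k) in
theorem topologicalKrullDim_of_isOpen {U : Set E} (hU : IsOpen U) (hne : U.Nonempty) :
    topologicalKrullDim U = Module.finrank k E := by
  refine le_antisymm ((topologicalKrullDim_subspace_le E U).trans
    (topologicalKrullDim_le_finrank k E)) ?_
  have hlength : (Module.finrank k E : WithBot ℕ∞) = Order.krullDim (Submodule k E) := by
    rw [← Module.coe_length, Module.length_eq_finrank]
    rfl
  obtain ⟨x, hx⟩ := hne
  exact hlength.trans_le
    (Order.krullDim_le_of_strictMono _ (irreducibleClosedsOfDirection_strictMono hU hx))

end Dimension

section SymSq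

variable {k : Type*} [Field k] {V : Type*} [AddCommGroup V] [Module k V]

/-- The product `V × V → S²V`. -/
def symMul : V →ₗ[k] V →ₗ[k] SymSq k V := TensorProduct.curry (Submodule.mkQ _)

theorem symMul_comm (v w : V) : symMul (k := k) v w = symMul w v :=
  (Submodule.Quotient.eq _).2 (Submodule.subset_span ⟨v, w, rfl⟩)

/-- The linear map `S²V → W` induced by a symmetric bilinear map. -/
def symSqLift {W : Type*} [AddCommGroup W] [Module k W] (β : V →ₗ[k] V →ₗ[k] W)
    (hβ : ∀ v w, β v w = β w v) : SymSq k V →ₗ[k] W :=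
  Submodule.liftQ _ (TensorProduct.lift β) <| by
    rw [Submodule.span_le]
    rintro _ ⟨v, w, rfl⟩
    simp [hβ v w]

theorem symSqLift_symMul {W : Type*} [AddCommGroup W] [Module k W] (β : V →ₗ[k] V →ₗ[k] W)
    (hβ : ∀ v w, β v w = β w v) (v w : V) : symSqLift β hβ (symMul v w) = β v w := by
  simp [symSqLift, symMul]

theorem symSq_hom_ext {W : Type*} [AddCommGroup W] [Module k W] {S T : SymSq k V →ₗ[k] W}
    (h : ∀ v w, S (symMul v w) = T (symMul v w)) : S = T :=
  Submodule.linearMap_qext _ (TensorProduct.ext' h)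

variable {ι : Type*} (e : Module.Basis ι k V)

/-- The bilinear map `V × V → k^(Sym2 ι)` giving the coordinates of a product of two vectors. -/
def symMulCoord : V →ₗ[k] V →ₗ[k] (Sym2 ι →₀ k) :=
  e.constr k fun i => e.constr k fun j => Finsupp.single s(i, j) 1

theorem symMulCoord_basis (i j : ι) :
    symMulCoord e (e i) (e j) = Finsupp.single s(i, j) 1 := by
  simp [symMulCoord]

theorem symMulCoord_comm (v w : V) : symMulCoord e v w = symMulCoord e w v := by
  have h : symMulCoord e = (symMulCoord e).flip :=
    e.ext fun i => e.ext fun j => by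
      rw [LinearMap.flip_apply, symMulCoord_basis, symMulCoord_basis, Sym2.eq_swap]
  exact LinearMap.congr_fun₂ h v w

/-- The family of the products of two basis vectors. -/
def symMulBasis : Sym2 ι → SymSq k V :=
  Sym2.lift ⟨fun i j => symMul (e i) (e j), fun _ _ => symMul_comm _ _⟩

theorem symSqLift_symMulCoord_comp :
    symSqLift (symMulCoord e) (symMulCoord_comm e) ∘ₗ Finsupp.linearCombination k (symMulBasis e) =
      LinearMap.id := by
  refine Finsupp.lhom_ext' fun s => LinearMap.ext_ring ?_
  induction s using Sym2.ind with
  | _ i j => simp [symMulBasis, symSqLift_symMul, symMulCoord_basis]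

theorem linearCombination_symMulBasis_comp :
    Finsupp.linearCombination k (symMulBasis e) ∘ₗ symSqLift (symMulCoord e) (symMulCoord_comm e) =
      LinearMap.id := by
  have h : (symMulCoord e).compr₂ (Finsupp.linearCombination k (symMulBasis e)) = symMul :=
    e.ext fun i => e.ext fun j => by simp [symMulCoord_basis, symMulBasis]
  refine symSq_hom_ext fun v w => ?_
  simpa [symSqLift_symMul] using LinearMap.congr_fun₂ h v w

/-- The basis of `S²V` consisting of the products of two basis vectors. -/
def symSqBasis : Module.Basis (Sym2 ι) k (SymSq k V) :=
  .ofRepr (.ofLinearMap _ _ (symSqLift_symMulCoord_comp e) (linearCombination_symMulBasis_comp e))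

theorem symSqBasis_mk (i j : ι) : symSqBasis e s(i, j) = symMul (e i) (e j) := by
  simp [symSqBasis, symMulBasis]

end SymSq

section LinearAlgebra

variable {k : Type*} [Field k] {E : Type*} [AddCommGroup E] [Module k E]
  {F : Type*} [AddCommGroup F] [Module k F]

theorem finrank_add_codim [FiniteDimensional k E] (Z : Submodule k E) :
    Module.finrank k Z + codim k Z = Module.finrank k E :=
  (add_comm _ _).trans Z.finrank_quotient_add_finrank

theorem codim_ker (g : E →ₗ[k] F) :
    codim k (LinearMap.ker g) = Module.finrank k (LinearMap.range g) :=
  g.quotKerEquivRange.finrank_eq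

theorem codim_ker_of_surjective {g : E →ₗ[k] F} (hg : Function.Surjective g) :
    codim k (LinearMap.ker g) = Module.finrank k F := by
  rw [codim_ker, LinearMap.range_eq_top.2 hg, finrank_top]

theorem finrank_ker_of_surjective [FiniteDimensional k E] {g : E →ₗ[k] F}
    (hg : Function.Surjective g) :
    Module.finrank k (LinearMap.ker g) = Module.finrank k E - Module.finrank k F := by
  rw [← finrank_add_codim (LinearMap.ker g), codim_ker_of_surjective hg, add_tsub_cancel_right]

theorem exists_surjective_ker_eq [FiniteDimensional k E] [FiniteDimensional k F]
    {Z : Submodule k E} (hZ : codim k Z = Module.finrank k F) :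
    ∃ g : E →ₗ[k] F, Function.Surjective g ∧ LinearMap.ker g = Z := by
  have e : (E ⧸ Z) ≃ₗ[k] F := LinearEquiv.ofFinrankEq _ _ hZ
  exact ⟨e.toLinearMap ∘ₗ Z.mkQ, e.surjective.comp Z.mkQ_surjective, by simp [LinearEquiv.ker_comp]⟩

end LinearAlgebra

section Maps

variable {k : Type*} [Field k]
  {A B V : Type*} [AddCommGroup A] [Module k A] [AddCommGroup B] [Module k B]
  [AddCommGroup V] [Module k V]
  {F : Type*} [AddCommGroup F] [Module k F]

variable (k A B V) in
/-- The map `m ↦ m(1)`, as a linear map. -/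
def oneHom : (B →ₗ[k] A ⊗[k] V) →ₗ[k] (B ⊗[k] V →ₗ[k] A ⊗[k] SymSq k V) :=
  LinearMap.compRight k (prodMap k A V) ∘ₗ LinearMap.rTensorHom V

variable (k A V F) in
/-- The map `g ↦ g*`, as a linear map. -/
def formStarHom : (A ⊗[k] SymSq k V →ₗ[k] F) →ₗ[k] (A ⊗[k] V →ₗ[k] (V →ₗ[k] F)) :=
  TensorProduct.lcurry (.id k) _ _ _ ∘ₗ LinearMap.lcomp k F (prodMap k A V)

theorem formStar_apply (g : A ⊗[k] SymSq k V →ₗ[k] F) (x : A ⊗[k] V) (v : V) :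
    formStar g x v = g (prodMap k A V (x ⊗ₜ v)) := rfl

theorem prodMap_tmul (x : A) (v w : V) :
    prodMap k A V ((x ⊗ₜ v) ⊗ₜ w) = x ⊗ₜ symMul v w := rfl

theorem mem_Zstar {Z : Submodule k (A ⊗[k] SymSq k V)} {x : A ⊗[k] V} :
    x ∈ Zstar Z ↔ ∀ v : V, prodMap k A V (x ⊗ₜ v) ∈ Z := by
  rw [Zstar, LinearMap.mem_ker, LinearMap.ext_iff]
  simp [formStar_apply]

theorem Zstar_ker (g : A ⊗[k] SymSq k V →ₗ[k] F) :
    Zstar (LinearMap.ker g) = LinearMap.ker (formStar g) := by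
  ext x
  rw [mem_Zstar, LinearMap.mem_ker, LinearMap.ext_iff]
  rfl

theorem mem_homStar {Z : Submodule k (A ⊗[k] SymSq k V)} {m : B →ₗ[k] A ⊗[k] V} :
    m ∈ homStar B Z ↔ Zof m ≤ Z := by
  constructor
  · rintro h _ ⟨x, rfl⟩
    induction x with
    | zero => simp
    | add x y hx hy => simpa using add_mem hx hy
    | tmul b v => exact mem_Zstar.1 (h ⟨b, rfl⟩) v
  · rintro h _ ⟨b, rfl⟩
    exact mem_Zstar.2 fun v => h ⟨b ⊗ₜ v, rfl⟩

theorem mem_homStar_ker {g : A ⊗[k] SymSq k V →ₗ[k] F} {m : B →ₗ[k] A ⊗[k] V} :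
    m ∈ homStar B (LinearMap.ker g) ↔ formStar g ∘ₗ m = 0 := by
  rw [homStar, Set.mem_ofPred_eq, Zstar_ker, LinearMap.range_le_ker_iff]

theorem Zof_le_ker {g : A ⊗[k] SymSq k V →ₗ[k] F} {m : B →ₗ[k] A ⊗[k] V} :
    Zof m ≤ LinearMap.ker g ↔ formStar g ∘ₗ m = 0 := by
  rw [← mem_homStar, mem_homStar_ker]

theorem surjective_of_formStar_surjective [Nontrivial V]
    {g : A ⊗[k] SymSq k V →ₗ[k] F} (hg : Function.Surjective (formStar g)) :
    Function.Surjective g := by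
  intro y
  obtain ⟨v, hv⟩ := exists_ne (0 : V)
  obtain ⟨φ, hφ⟩ := Module.Projective.exists_dual_ne_zero k hv
  obtain ⟨x, hx⟩ := hg (((φ v)⁻¹ • φ).smulRight y)
  refine ⟨prodMap k A V (x ⊗ₜ v), ?_⟩
  rw [← formStar_apply, hx]
  simp [hφ]

variable [FiniteDimensional k V]

variable (k V) in
theorem finrank_symSq : Module.finrank k (SymSq k V) = (Module.finrank k V + 1).choose 2 := by
  rw [Module.finrank_eq_card_basis (symSqBasis (Module.finBasis k V)), Sym2.card, Fintype.card_fin]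

theorem codim_Zstar_ker_eq_iff [FiniteDimensional k F] (g : A ⊗[k] SymSq k V →ₗ[k] F) :
    codim k (Zstar (LinearMap.ker g)) = Module.finrank k V * Module.finrank k F ↔
      Function.Surjective (formStar g) := by
  rw [Zstar_ker, codim_ker, surjective_iff_finrank_le_finrank_range, Module.finrank_linearMap]
  refine ⟨fun h => h.ge, fun h => le_antisymm ?_ h⟩
  rw [← Module.finrank_linearMap]
  exact Submodule.finrank_le _

variable [FiniteDimensional k A]

theorem Zof_eq_ker_iff {g : A ⊗[k] SymSq k V →ₗ[k] F} (hg : Function.Surjective g)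
    {m : B →ₗ[k] A ⊗[k] V} (hm : formStar g ∘ₗ m = 0) :
    Zof m = LinearMap.ker g ↔ Module.finrank k (A ⊗[k] SymSq k V) - Module.finrank k F ≤
      Module.finrank k (LinearMap.range (one m)) := by
  rw [← finrank_ker_of_surjective hg]
  exact ⟨fun h => (congrArg (fun Z : Submodule k _ => Module.finrank k Z) h).ge,
    Submodule.eq_of_le_of_finrank_le (Zof_le_ker.2 hm)⟩

variable {f : ℕ} [FiniteDimensional k B]

theorem corank_one_eq_codim_Zof (hV : Module.finrank k V = 4)
    (hab : 5 * Module.finrank k A ≤ 2 * Module.finrank k B) (m : B →ₗ[k] A ⊗[k] V) :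
    corank k (one m) = codim k (Zof m) := by
  have hker := (one m).finrank_range_add_finrank_ker
  have hrange : Module.finrank k (LinearMap.range (one m)) + codim k (Zof m) = _ :=
    finrank_add_codim (Zof m)
  rw [Module.finrank_tensorProduct, finrank_symSq, hV,
    show Nat.choose (4 + 1) 2 = 10 from rfl] at hrange
  rw [Module.finrank_tensorProduct, hV] at hker
  change min _ (codim k (Zof m)) = _
  lia

theorem mem_locusW_iff (hV : Module.finrank k V = 4)
    (hab : 5 * Module.finrank k A ≤ 2 * Module.finrank k B) {m : B →ₗ[k] A ⊗[k] V} :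
    m ∈ locusW k A B V f ↔ f ≤ codim k (Zof m) := by
  rw [locusW, Set.mem_ofPred_eq, corank_one_eq_codim_Zof hV hab]

theorem mem_locusPW_iff (hV : Module.finrank k V = 4)
    (hab : 5 * Module.finrank k A ≤ 2 * Module.finrank k B) {m : B →ₗ[k] A ⊗[k] V} :
    m ∈ locusPW k A B V f ↔ ∃ g : A ⊗[k] SymSq k V →ₗ[k] (Fin f → k),
      LinearMap.ker g = Zof m ∧ Function.Surjective (formStar g) := by
  have : Nontrivial V := Module.nontrivial_of_finrank_pos (R := k) (by lia)
  rw [locusPW, Set.mem_ofPred_eq, mem_locusW_iff hV hab]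
  constructor
  · rintro ⟨-, hZ, hZstar⟩
    obtain ⟨g, -, hgZ⟩ := exists_surjective_ker_eq (F := Fin f → k)
      (hZ.trans (Module.finrank_fin_fun k).symm)
    exact ⟨g, hgZ, (codim_Zstar_ker_eq_iff g).1 (by simpa [hV, hgZ] using hZstar)⟩
  · rintro ⟨g, hgZ, hg⟩
    have hZ := codim_ker_of_surjective (surjective_of_formStar_surjective hg)
    have hZstar := (codim_Zstar_ker_eq_iff g).2 hg
    rw [hgZ, Module.finrank_fin_fun] at hZ hZstar
    exact ⟨hZ.ge, hZ, hV ▸ hZstar⟩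

end Maps

section ApolarSystem

variable {k : Type*} [Field k] {ι σ L J : Type*} [Fintype ι] [Fintype σ]

/-- In coordinates, the map `g* : A ⊗ V → V^∨` attached to the linear form `g` on `A ⊗ S²V` with
coefficients `Q`. -/
def contract (Q : ι → Sym2 σ → k) : (ι → σ → k) →ₗ[k] (σ → k) where
  toFun x r := ∑ i, ∑ s, Q i s(r, s) * x i s
  map_add' x y := by
    ext
    simp [mul_add, Finset.sum_add_distrib]
  map_smul' c x := by
    ext
    simp [Finset.mul_sum, mul_left_comm]

theorem contract_apply (Q : ι → Sym2 σ → k) (x : ι → σ → k) (r : σ) :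
    contract Q x r = ∑ i, ∑ s, Q i s(r, s) * x i s :=
  rfl

theorem contract_zero : contract (0 : ι → Sym2 σ → k) = 0 := by
  ext
  simp [contract_apply]

theorem contract_single [DecidableEq ι] [DecidableEq σ] (Q : ι → Sym2 σ → k) (i : ι) (s r : σ) :
    contract Q (Pi.single i (Pi.single s 1)) r = Q i s(r, s) := by
  rw [contract_apply, Fintype.sum_eq_single i, Fintype.sum_eq_single s]
  · simp
  · intro s' hs
    simp [hs]
  · intro i' hi
    simp [hi]

theorem contract_sumElim {ι' : Type*} [Fintype ι'] (Q : ι ⊕ ι' → Sym2 σ → k) (x : ι → σ → k)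
    (x' : ι' → σ → k) : contract Q (Sum.elim x x') =
      contract (fun i => Q (.inl i)) x + contract (fun i => Q (.inr i)) x' := by
  ext r
  simp [contract_apply]

/-- In coordinates: the subspace of `A ⊗ V` spanned by the `u l` generates in `A ⊗ S²V` the common
kernel `Z` of the linear forms `q j`, and `Z*` has the largest possible codimension. -/
structure IsApolarSystem [Fintype J] (u : L → ι → σ → k) (q : J → ι → Sym2 σ → k) : Prop where
  contract_eq_zero : ∀ j l, contract (q j) (u l) = 0
  exists_eq_sum : ∀ Q : ι → Sym2 σ → k, (∀ l, contract Q (u l) = 0) →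
    ∃ c : J → k, Q = ∑ j, c j • q j
  exists_contract_eq : ∀ y : J → σ → k, ∃ x : ι → σ → k, ∀ j, contract (q j) x = y j

namespace IsApolarSystem

variable [Fintype J] {u : L → ι → σ → k} {q : J → ι → Sym2 σ → k}

theorem sumElim {ι' L' J' : Type*} [Fintype ι'] [Fintype J'] {u' : L' → ι' → σ → k}
    {q' : J' → ι' → Sym2 σ → k} (h : IsApolarSystem u q) (h' : IsApolarSystem u' q') :
    IsApolarSystem (Sum.elim (fun l => Sum.elim (u l) 0) (fun l => Sum.elim 0 (u' l)))
      (Sum.elim (fun j => Sum.elim (q j) 0) (fun j => Sum.elim 0 (q' j))) where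
  contract_eq_zero := by
    rintro (j | j) (l | l) <;>
      simp [contract_sumElim, ← Pi.zero_def, contract_zero, h.contract_eq_zero, h'.contract_eq_zero]
  exists_eq_sum Q hQ := by
    obtain ⟨c, hc⟩ := h.exists_eq_sum (fun i => Q (.inl i)) fun l => by
      simpa [contract_sumElim] using hQ (.inl l)
    obtain ⟨c', hc'⟩ := h'.exists_eq_sum (fun i => Q (.inr i)) fun l => by
      simpa [contract_sumElim] using hQ (.inr l)
    refine ⟨Sum.elim c c', ?_⟩
    ext (i | i) n
    · simpa using congrFun₂ hc i n
    · simpa using congrFun₂ hc' i n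
  exists_contract_eq y := by
    obtain ⟨x, hx⟩ := h.exists_contract_eq fun j => y (.inl j)
    obtain ⟨x', hx'⟩ := h'.exists_contract_eq fun j => y (.inr j)
    refine ⟨Sum.elim x x', ?_⟩
    rintro (j | j) <;> simp [contract_sumElim, ← Pi.zero_def, contract_zero, hx, hx']

theorem sumElim_zero (h : IsApolarSystem u q) (L' : Type*) :
    IsApolarSystem (Sum.elim u (0 : L' → ι → σ → k)) q where
  contract_eq_zero
    | j, .inl l => h.contract_eq_zero j l
    | _, .inr _ => map_zero _
  exists_eq_sum Q hQ := h.exists_eq_sum Q fun l => hQ (.inl l)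
  exists_contract_eq := h.exists_contract_eq

variable [DecidableEq ι] [DecidableEq σ]

theorem of_indicator {p : L → ι × σ} {p' : L → Option (ι × σ)} {S : J → Finset (ι × Sym2 σ)}
    {w : J → σ → ι × σ}
    (hS : ∀ j l r, ((p l).1, s(r, (p l).2)) ∈ S j ↔ ∃ t ∈ p' l, (t.1, s(r, t.2)) ∈ S j)
    (hQ : ∀ Q : ι → Sym2 σ → k,
      (∀ l r, Q (p l).1 s(r, (p l).2) = (p' l).elim 0 fun t => Q t.1 s(r, t.2)) →
        ∃ c : J → k, ∀ i n, Q i n = ∑ j, if (i, n) ∈ S j then c j else 0)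
    (hw : ∀ j r j' r', ((w j r).1, s(r', (w j r).2)) ∈ S j' ↔ j' = j ∧ r' = r) :
    IsApolarSystem (k := k) (fun l => Pi.single (p l).1 (Pi.single (p l).2 1) -
      (p' l).elim 0 fun t => Pi.single t.1 (Pi.single t.2 1))
      (fun j i n => if (i, n) ∈ S j then 1 else 0) := by
  have hcontract (Q : ι → Sym2 σ → k) (l r) : contract Q (Pi.single (p l).1 (Pi.single (p l).2 1) -
      (p' l).elim 0 fun t => Pi.single t.1 (Pi.single t.2 1)) r =
      Q (p l).1 s(r, (p l).2) - (p' l).elim 0 fun t => Q t.1 s(r, t.2) := by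
    cases p' l <;> simp [contract_single]
  refine ⟨fun j l => funext fun r => ?_, fun Q h => ?_, fun y => ?_⟩
  · have := hS j l r
    rw [hcontract, Pi.zero_apply, sub_eq_zero]
    cases hp : p' l <;> simp_all
  · obtain ⟨c, hc⟩ := hQ Q fun l r => sub_eq_zero.1 ((hcontract Q l r).symm.trans (by simp [h]))
    exact ⟨c, funext₂ fun i n => by simp [hc]⟩
  · classical
    refine ⟨∑ j, ∑ r, y j r • Pi.single (w j r).1 (Pi.single (w j r).2 1), fun j => ?_⟩
    ext r
    simp [contract_single, hw, ite_and]

end IsApolarSystem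

variable (k) in
/-- There is an apolar system of `f` linear forms and `b` vectors with `dim A = a` and
`dim V = 4`. -/
def HasApolarSystem (a b f : ℕ) : Prop :=
  ∃ (ι L J : Type) (_ : Fintype ι) (_ : Fintype L) (_ : Fintype J),
    Fintype.card ι = a ∧ Fintype.card L = b ∧ Fintype.card J = f ∧
      ∃ (u : L → ι → Fin 4 → k) (q : J → ι → Sym2 (Fin 4) → k), IsApolarSystem u q

namespace HasApolarSystem

theorem zero : HasApolarSystem k 0 0 0 :=
  ⟨Empty, Empty, Empty, inferInstance, inferInstance, inferInstance, rfl, rfl, rfl,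
    Empty.elim, Empty.elim, Empty.rec, fun _ _ => ⟨0, funext Empty.rec⟩, fun _ => ⟨0, Empty.rec⟩⟩

theorem add {a b f a' b' f' : ℕ} (h : HasApolarSystem k a b f) (h' : HasApolarSystem k a' b' f') :
    HasApolarSystem k (a + a') (b + b') (f + f') := by
  obtain ⟨ι, L, J, _, _, _, rfl, rfl, rfl, u, q, h⟩ := h
  obtain ⟨ι', L', J', _, _, _, rfl, rfl, rfl, u', q', h'⟩ := h'
  exact ⟨ι ⊕ ι', L ⊕ L', J ⊕ J', inferInstance, inferInstance, inferInstance,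
    Fintype.card_sum, Fintype.card_sum, Fintype.card_sum, _, _, h.sumElim h'⟩

theorem mono {a b b' f : ℕ} (h : HasApolarSystem k a b f) (hb : b ≤ b') :
    HasApolarSystem k a b' f := by
  obtain ⟨ι, L, J, _, _, _, rfl, rfl, rfl, u, q, h⟩ := h
  exact ⟨ι, L ⊕ Fin (b' - Fintype.card L), J, inferInstance, inferInstance, inferInstance, rfl,
    by simp [hb], rfl, _, _, h.sumElim_zero _⟩

theorem nsmul {a b f : ℕ} (h : HasApolarSystem k a b f) (n : ℕ) :
    HasApolarSystem k (n * a) (n * b) (n * f) := by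
  induction n with
  | zero => simpa using zero
  | succ n ih => simpa only [add_mul, one_mul] using ih.add h

theorem of_isApolarSystem {a b f : ℕ} {u : Fin b → Fin a → Fin 4 → k}
    {q : Fin f → Fin a → Sym2 (Fin 4) → k} (h : IsApolarSystem u q) : HasApolarSystem k a b f :=
  ⟨Fin a, Fin b, Fin f, inferInstance, inferInstance, inferInstance, Fintype.card_fin a,
    Fintype.card_fin b, Fintype.card_fin f, u, q, h⟩

end HasApolarSystem

end ApolarSystem

section Witnesses

variable {k : Type*} [Field k]

namespace HasApolarSystem

-- The witnesses were found by a computer search over systems with few monomials.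

theorem two_five_zero : HasApolarSystem k 2 5 0 := by
  refine of_isApolarSystem (.of_indicator
    (p := ![(1, 0), (1, 1), (1, 3), (0, 1), (1, 2)])
    (p' := ![some (1, 2), some (0, 0), some (0, 2), none, some (0, 3)])
    (S := ![])
    (w := ![])
    (by decide +kernel) (fun Q hQ => ⟨![], ?_⟩) (by decide +kernel))
  simp [Fin.forall_fin_succ, Sym2.forall, Sym2.eq_swap] at hQ ⊢
  grind

theorem three_eight_one : HasApolarSystem k 3 8 1 := by
  refine of_isApolarSystem (.of_indicator
    (p := ![(2, 3), (1, 0), (0, 2), (2, 0), (1, 3), (1, 2), (2, 1), (1, 1)])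
    (p' := ![some (0, 1), some (0, 1), some (2, 0), none, some (0, 0), some (0, 3), none,
      some (2, 2)])
    (S := ![{(0, s(0, 0)), (0, s(1, 3)), (1, s(0, 3)), (1, s(1, 2)), (2, s(2, 2)), (2, s(3, 3))}])
    (w := ![![(0, 0), (0, 3), (1, 1), (0, 1)]])
    (by decide +kernel) (fun Q hQ => ⟨![Q 0 s(0, 0)], ?_⟩) (by decide +kernel))
  simp [Fin.forall_fin_succ, Sym2.forall, Sym2.eq_swap] at hQ ⊢
  grind

theorem four_ten_one : HasApolarSystem k 4 10 1 := by
  refine of_isApolarSystem (.of_indicator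
    (p := ![(0, 3), (2, 1), (0, 0), (2, 2), (3, 0), (0, 1), (1, 1), (0, 3), (1, 0), (3, 2)])
    (p' := ![some (2, 3), some (1, 2), some (3, 1), some (3, 1), some (1, 3), some (3, 3),
      some (2, 0), some (0, 2), none, none])
    (S := ![{(0, s(0, 1)), (1, s(2, 2)), (1, s(3, 3)), (2, s(1, 2)), (3, s(0, 3)), (3, s(1, 1))}])
    (w := ![![(0, 1), (0, 0), (1, 2), (1, 3)]])
    (by decide +kernel) (fun Q hQ => ⟨![Q 0 s(0, 1)], ?_⟩) (by decide +kernel))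
  simp [Fin.forall_fin_succ, Sym2.forall, Sym2.eq_swap] at hQ ⊢
  grind

theorem five_twelve_two : HasApolarSystem k 5 12 2 := by
  refine of_isApolarSystem (.of_indicator
    (p := ![(2, 1), (0, 0), (1, 0), (0, 0), (1, 1), (1, 2), (4, 0), (3, 0), (3, 3), (2, 3), (4, 3),
      (0, 1)])
    (p' := ![some (4, 2), none, some (4, 1), some (3, 1), some (3, 2), some (0, 3), some (2, 3),
      some (1, 3), some (2, 2), some (0, 2), some (0, 0), some (2, 0)])
    (S := ![{(0, s(1, 1)), (0, s(2, 2)), (2, s(0, 1)), (2, s(2, 3)), (3, s(3, 3)), (4, s(0, 2))},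
      {(0, s(3, 3)), (1, s(0, 1)), (1, s(2, 3)), (3, s(0, 2)), (4, s(1, 1))}])
    (w := ![![(2, 1), (0, 1), (0, 2), (2, 2)], ![(1, 1), (1, 0), (1, 3), (0, 3)]])
    (by decide +kernel) (fun Q hQ => ⟨![Q 0 s(1, 1), Q 0 s(3, 3)], ?_⟩) (by decide +kernel))
  simp [Fin.forall_fin_succ, Sym2.forall, Sym2.eq_swap] at hQ ⊢
  grind

theorem six_fifteen_two : HasApolarSystem k 6 15 2 := by
  refine of_isApolarSystem (.of_indicator
    (p := ![(0, 2), (2, 3), (0, 0), (0, 3), (3, 3), (2, 2), (4, 1), (3, 1), (5, 0), (3, 0), (4, 3),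
      (2, 2), (3, 2), (4, 3), (4, 0)])
    (p' := ![some (5, 2), some (5, 1), some (5, 0), some (4, 2), some (2, 0), some (5, 3),
      some (1, 2), some (1, 3), some (5, 2), some (0, 1), none, some (1, 0), some (2, 1),
      some (0, 0), some (1, 1)])
    (S := ![{(0, s(1, 3)), (1, s(2, 2)), (2, s(0, 0)), (3, s(0, 3)), (4, s(1, 2))}, {(1, s(0, 1)),
      (2, s(1, 2)), (2, s(3, 3)), (3, s(2, 2)), (4, s(0, 0)), (5, s(1, 3))}])
    (w := ![![(2, 0), (0, 3), (1, 2), (0, 1)], ![(1, 1), (1, 0), (2, 1), (2, 3)]])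
    (by decide +kernel) (fun Q hQ => ⟨![Q 0 s(1, 3), Q 1 s(0, 1)], ?_⟩) (by decide +kernel))
  simp [Fin.forall_fin_succ, Sym2.forall, Sym2.eq_swap] at hQ ⊢
  grind

theorem even {c f : ℕ} (h : 5 * f ≤ 4 * c) : HasApolarSystem k (2 * c) (5 * c) f := by
  have ten : HasApolarSystem k 10 25 4 := (five_twelve_two.add five_twelve_two).mono (by norm_num)
  have add_copies (c₀ f₀ j : ℕ) (h₀ : HasApolarSystem k (2 * c₀) (5 * c₀) f₀)
      (hf : f = 4 * j + f₀) (hc : 5 * j + c₀ ≤ c) : HasApolarSystem k (2 * c) (5 * c) f := by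
    convert ((ten.nsmul j).add (two_five_zero.nsmul (c - 5 * j - c₀))).add h₀ using 1 <;> lia
  obtain hr | hr | hr | hr : f % 4 = 0 ∨ f % 4 = 1 ∨ f % 4 = 2 ∨ f % 4 = 3 := by lia
  · exact add_copies 0 0 (f / 4) zero (by lia) (by lia)
  · exact add_copies 2 1 (f / 4) four_ten_one (by lia) (by lia)
  · exact add_copies 3 2 (f / 4) six_fifteen_two (by lia) (by lia)
  · exact add_copies 4 3 (f / 4) (five_twelve_two.add three_eight_one) (by lia) (by lia)

theorem of_le_of_lt {a b f : ℕ} (hf : 1 ≤ f) (hab : 5 * a ≤ 2 * b) (haf : 5 * f < 2 * a) :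
    HasApolarSystem k a b f := by
  obtain ⟨c, rfl | rfl⟩ := Nat.even_or_odd' a
  · exact (even (by lia)).mono (by lia)
  · have h := (even (k := k) (c := c - 1) (f := f - 1) (by lia)).add three_eight_one
    convert h.mono (b' := b) (by lia) using 1 <;> lia

end HasApolarSystem

end Witnesses

section Existence

variable {k : Type*} [Field k]
  {A B V : Type*} [AddCommGroup A] [Module k A] [AddCommGroup B] [Module k B]
  [AddCommGroup V] [Module k V] {ι σ L J : Type*}

/-- The linear form on `A ⊗ S²V` with the given coefficients. -/
def formOfCoord (eA : Module.Basis ι k A) (eV : Module.Basis σ k V) :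
    (ι → Sym2 σ → k) ≃ₗ[k] Module.Dual k (A ⊗[k] SymSq k V) :=
  (LinearEquiv.curry k k ι (Sym2 σ)).symm ≪≫ₗ (eA.tensorProduct (symSqBasis eV)).constr k

theorem formOfCoord_tmul (eA : Module.Basis ι k A) (eV : Module.Basis σ k V) (Q : ι → Sym2 σ → k)
    (i : ι) (n : Sym2 σ) : formOfCoord eA eV Q (eA i ⊗ₜ symSqBasis eV n) = Q i n := by
  rw [← Module.Basis.tensorProduct_apply]
  exact Module.Basis.constr_basis _ k _ _

variable [Fintype ι] [Fintype σ]

/-- The element of `A ⊗ V` with the given coordinates. -/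
def vecOfCoord (eA : Module.Basis ι k A) (eV : Module.Basis σ k V) (x : ι → σ → k) : A ⊗[k] V :=
  ∑ i, ∑ s, x i s • (eA i ⊗ₜ[k] eV s)

theorem formStar_formOfCoord (eA : Module.Basis ι k A) (eV : Module.Basis σ k V)
    (Q : ι → Sym2 σ → k) (x : ι → σ → k) (r : σ) :
    formStar (formOfCoord eA eV Q) (vecOfCoord eA eV x) (eV r) = contract Q x r := by
  simp [formStar_apply, vecOfCoord, prodMap_tmul, ← symSqBasis_mk,
    formOfCoord_tmul, contract_apply, mul_comm, Sym2.eq_swap]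

theorem IsApolarSystem.exists_Zof_eq_ker [Fintype J] {u : L → ι → σ → k}
    {q : J → ι → Sym2 σ → k} (h : IsApolarSystem u q) (eA : Module.Basis ι k A)
    (eB : Module.Basis L k B) (eV : Module.Basis σ k V) :
    ∃ (m : B →ₗ[k] A ⊗[k] V) (g : A ⊗[k] SymSq k V →ₗ[k] (J → k)),
      Function.Surjective (formStar g) ∧ Zof m = LinearMap.ker g := by
  let m : B →ₗ[k] A ⊗[k] V := eB.constr k fun l => vecOfCoord eA eV (u l)
  have hm (l) : m (eB l) = vecOfCoord eA eV (u l) := eB.constr_basis k _ l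
  let g : A ⊗[k] SymSq k V →ₗ[k] (J → k) := LinearMap.pi fun j => formOfCoord eA eV (q j)
  have hg (x r j) : formStar g (vecOfCoord eA eV x) (eV r) j = contract (q j) x r :=
    formStar_formOfCoord eA eV (q j) x r
  refine ⟨m, g, fun T => ?_, le_antisymm ?_ fun x hx => ?_⟩
  · obtain ⟨x, hx⟩ := h.exists_contract_eq fun j r => T (eV r) j
    exact ⟨vecOfCoord eA eV x, eV.ext fun r => funext fun j => by rw [hg, hx]⟩
  · exact Zof_le_ker.2 <| eB.ext fun l => eV.ext fun r => funext fun j => by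
      rw [LinearMap.comp_apply, hm, hg, h.contract_eq_zero]
      rfl
  · refine (Subspace.forall_mem_dualAnnihilator_apply_eq_zero_iff _ _).1 fun φ hφ => ?_
    obtain ⟨Q, rfl⟩ := (formOfCoord eA eV).surjective φ
    have hQm : formStar (formOfCoord eA eV Q) ∘ₗ m = 0 :=
      Zof_le_ker.1 fun z hz => (Submodule.mem_dualAnnihilator _).1 hφ z hz
    obtain ⟨c, rfl⟩ := h.exists_eq_sum Q fun l => by
      ext r
      rw [← formStar_formOfCoord eA eV, ← hm]
      exact LinearMap.congr_fun₂ hQm (eB l) (eV r)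
    have hxj (j) : formOfCoord eA eV (q j) x = 0 := congrFun (LinearMap.mem_ker.1 hx) j
    simp [hxj]

theorem HasApolarSystem.exists_Zof_eq_ker [FiniteDimensional k A] [FiniteDimensional k B]
    [FiniteDimensional k V] (hV : Module.finrank k V = 4) {f : ℕ}
    (h : HasApolarSystem k (Module.finrank k A) (Module.finrank k B) f) :
    ∃ (m : B →ₗ[k] A ⊗[k] V) (g : A ⊗[k] SymSq k V →ₗ[k] (Fin f → k)),
      Function.Surjective (formStar g) ∧ Zof m = LinearMap.ker g := by
  obtain ⟨ι, L, J, _, _, _, hι, hL, hJ, u, q, h⟩ := h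
  obtain ⟨m, g, hg, hm⟩ := h.exists_Zof_eq_ker
    ((Module.finBasis k A).reindex (Fintype.equivFinOfCardEq hι).symm)
    ((Module.finBasis k B).reindex (Fintype.equivFinOfCardEq hL).symm)
    ((Module.finBasis k V).reindex (finCongr hV))
  let e := LinearEquiv.funCongrLeft k k (Fintype.equivFinOfCardEq hJ).symm
  exact ⟨m, e.toLinearMap ∘ₗ g, (LinearEquiv.congrRight e).surjective.comp hg,
    hm.trans (LinearEquiv.ker_comp e g).symm⟩

end Existence

section ProjKer

variable {k : Type*} [Field k]
  {E : Type*} [AddCommGroup E] [Module k E] {F : Type*} [AddCommGroup F] [Module k F]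
  {G : Type*} [AddCommGroup G] [Module k G] {H : Type*} [AddCommGroup H] [Module k H]

theorem regularOn_id (X : Set E) : RegularOn k (fun x : E => x) X :=
  (RegularOn.linear (LinearMap.id : E →ₗ[k] E) X :)

theorem regularOn_fst (X : Set (E × F)) : RegularOn k (fun p : E × F => p.1) X :=
  (RegularOn.linear (LinearMap.fst k E F) X :)

theorem regularOn_snd (X : Set (E × F)) : RegularOn k (fun p : E × F => p.2) X :=
  (RegularOn.linear (LinearMap.snd k E F) X :)

theorem RegularOn.linearMap_comp [FiniteDimensional k G] [FiniteDimensional k H] {X : Set E}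
    {S : E → G →ₗ[k] H} {T : E → F →ₗ[k] G} (hS : RegularOn k S X) (hT : RegularOn k T X) :
    RegularOn k (fun x => S x ∘ₗ T x) X :=
  RegularOn.bilin (LinearMap.llcomp k F G H) hS hT

/-- The projection of `F` to the kernel of `Φ` along the image of `s`. It is one only when `Φ ∘ s`
is invertible: otherwise `Ring.inverse` is zero and `projKer s Φ` is the identity. -/
def projKer (s : H →ₗ[k] F) (Φ : F →ₗ[k] H) : F →ₗ[k] F :=
  LinearMap.id - s ∘ₗ (Ring.inverse (Φ ∘ₗ s : Module.End k H)) ∘ₗ Φ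

variable {s : H →ₗ[k] F} {Φ : F →ₗ[k] H}

theorem comp_projKer (h : IsUnit (Φ ∘ₗ s : Module.End k H)) : Φ ∘ₗ projKer s Φ = 0 := by
  ext x
  have hx := LinearMap.congr_fun (Ring.mul_inverse_cancel _ h) (Φ x)
  simp only [Module.End.mul_apply, LinearMap.comp_apply, Module.End.one_apply] at hx
  simp [projKer, hx]

theorem projKer_comp (h : IsUnit (Φ ∘ₗ s : Module.End k H)) : projKer s Φ ∘ₗ s = 0 := by
  ext x
  have hx := LinearMap.congr_fun (Ring.inverse_mul_cancel _ h) x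
  simp only [Module.End.mul_apply, LinearMap.comp_apply, Module.End.one_apply] at hx
  simp [projKer, hx]

theorem projKer_comp_of_comp_eq_zero {m : G →ₗ[k] F} (hm : Φ ∘ₗ m = 0) :
    projKer s Φ ∘ₗ m = m := by
  ext x
  have hx : Φ (m x) = 0 := LinearMap.congr_fun hm x
  simp [projKer, hx]

theorem comp_projKer_of_comp_eq_zero {g : F →ₗ[k] G} (hg : g ∘ₗ s = 0) :
    g ∘ₗ projKer s Φ = g := by
  rw [projKer, LinearMap.comp_sub, ← LinearMap.comp_assoc, hg, LinearMap.zero_comp, sub_zero,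
    LinearMap.comp_id]

theorem exists_subtype_comp_eq_projKer (h : IsUnit (Φ ∘ₗ s : Module.End k H)) :
    ∃ κ : F →ₗ[k] LinearMap.ker Φ, (LinearMap.ker Φ).subtype ∘ₗ κ = projKer s Φ ∧
      κ ∘ₗ (LinearMap.ker Φ).subtype = LinearMap.id ∧ κ ∘ₗ s = 0 := by
  refine ⟨(projKer s Φ).codRestrict _ fun x => LinearMap.congr_fun (comp_projKer h) x,
    LinearMap.subtype_comp_codRestrict _ _ _, LinearMap.ext fun x => Subtype.ext ?_,
    LinearMap.ext fun x => Subtype.ext (LinearMap.congr_fun (projKer_comp h) x)⟩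
  exact LinearMap.congr_fun (projKer_comp_of_comp_eq_zero (LinearMap.comp_ker_subtype Φ)) x

theorem add_sub_comp_comp_eq {Φ' : F →ₗ[k] H} {κ : F →ₗ[k] LinearMap.ker Φ}
    (hκ : (LinearMap.ker Φ).subtype ∘ₗ κ = projKer s Φ) (h : Φ' ∘ₗ s = Φ ∘ₗ s) :
    Φ + ((Φ' - Φ) ∘ₗ (LinearMap.ker Φ).subtype) ∘ₗ κ = Φ' := by
  rw [LinearMap.comp_assoc, hκ,
    comp_projKer_of_comp_eq_zero (by rw [LinearMap.sub_comp, h, sub_self]), add_sub_cancel]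

theorem surjective_of_isUnit_comp (h : IsUnit (Φ ∘ₗ s : Module.End k H)) :
    Function.Surjective Φ :=
  Function.Surjective.of_comp (g := s) ((Module.End.isUnit_iff _).1 h).2

theorem exists_comp_eq_id (h : Function.Surjective Φ) : ∃ s : H →ₗ[k] F, Φ ∘ₗ s = LinearMap.id :=
  Φ.exists_rightInverse_of_surjective (LinearMap.range_eq_top.2 h)

theorem RegularOn.projKer [FiniteDimensional k F] [FiniteDimensional k H] {X : Set E}
    {Ψ : E → F →ₗ[k] H} (hΨ : RegularOn k Ψ X)
    (hX : ∀ x ∈ X, IsUnit (Ψ x ∘ₗ s : Module.End k H)) :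
    RegularOn k (fun x => projKer s (Ψ x)) X :=
  (RegularOn.const _ X).sub ((RegularOn.const s X).linearMap_comp
    ((RegularOn.ringInverse (hΨ.linearMap_comp (RegularOn.const s X)) hX).linearMap_comp hΨ))

theorem exists_isUnit_comp_and [Infinite k] [FiniteDimensional k H]
    {Φ Φ' : F →ₗ[k] H} (h : Function.Surjective Φ) (h' : Function.Surjective Φ') :
    ∃ s : H →ₗ[k] F, IsUnit (Φ ∘ₗ s : Module.End k H) ∧ IsUnit (Φ' ∘ₗ s : Module.End k H) := by
  obtain ⟨s, hs⟩ := exists_comp_eq_id h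
  obtain ⟨s', hs'⟩ := exists_comp_eq_id h'
  have hopen (Ψ : F →ₗ[k] H) :
      IsOpen (Set.univ ∩ {t : H →ₗ[k] F | IsUnit (Ψ ∘ₗ t : Module.End k H)}) :=
    RegularOn.isOpen_inter_isUnit (RegularOn.linear (LinearMap.compRight k Ψ) _) isOpen_univ
  obtain ⟨t, ht, ht'⟩ := exists_lineMap_mem_and_mem (k := k) (hopen Φ) (hopen Φ') (x := s) (y := s')
    ⟨trivial, by rw [Set.mem_ofPred_eq, hs]; exact isUnit_one⟩
    ⟨trivial, by rw [Set.mem_ofPred_eq, hs']; exact isUnit_one⟩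
  exact ⟨_, ht.2, ht'.2⟩

end ProjKer

section KernelFamily

variable {k : Type*} [Field k]
  {E : Type*} [AddCommGroup E] [Module k E] {F : Type*} [AddCommGroup F] [Module k F]
  {H : Type*} [AddCommGroup H] [Module k H] {B : Type*} [AddCommGroup B] [Module k B]
  [FiniteDimensional k F] [FiniteDimensional k H]
  [TopologicalSpace (E × (B →ₗ[k] F))] [ZariskiSpace k (E × (B →ₗ[k] F))]

variable (B) in
theorem isOpen_setOf_isUnit_fst (Φ : E →ₗ[k] F →ₗ[k] H) (s : H →ₗ[k] F) :
    IsOpen {p : E × (B →ₗ[k] F) | IsUnit (Φ p.1 ∘ₗ s : Module.End k H)} := by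
  simpa only [Set.univ_inter] using RegularOn.isOpen_inter_isUnit
    (((regularOn_fst _).map Φ).linearMap_comp (RegularOn.const s Set.univ)) isOpen_univ

variable (B) in
theorem isPreirreducible_kernelFamily [Infinite k] (Φ : E →ₗ[k] F →ₗ[k] H) :
    IsPreirreducible
      {p : E × (B →ₗ[k] F) | Function.Surjective (Φ p.1) ∧ Φ p.1 ∘ₗ p.2 = 0} := by
  refine isPreirreducible_of_forall_pair ?_
  rintro p ⟨hp, hpm⟩ q ⟨hq, hqm⟩
  obtain ⟨s, hsp, hsq⟩ := exists_isUnit_comp_and hp hq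
  set X := {p : E × (B →ₗ[k] F) | IsUnit (Φ p.1 ∘ₗ s : Module.End k H)}
  have hX : IsOpen X := isOpen_setOf_isUnit_fst B Φ s
  have hretract : RegularOn k (fun p => (p.1, projKer s (Φ p.1) ∘ₗ p.2)) X :=
    (regularOn_fst X).prodMk
      ((((regularOn_fst X).map Φ).projKer fun _ hx => hx).linearMap_comp (regularOn_snd X))
  refine ⟨_, ?_, (isPreirreducible_of_isOpen k hX).image _ hretract.continuousOn,
    ⟨p, hsp, Prod.ext rfl (projKer_comp_of_comp_eq_zero hpm)⟩,
    ⟨q, hsq, Prod.ext rfl (projKer_comp_of_comp_eq_zero hqm)⟩⟩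
  rintro _ ⟨x, hx, rfl⟩
  refine ⟨surjective_of_isUnit_comp hx, ?_⟩
  rw [← LinearMap.comp_assoc, comp_projKer hx, LinearMap.zero_comp]

theorem isOpen_image_fst_kernelFamily_inter [TopologicalSpace E] [ZariskiSpace k E]
    (Φ : E →ₗ[k] F →ₗ[k] H) {O : Set (E × (B →ₗ[k] F))} (hO : IsOpen O) :
    IsOpen (Prod.fst '' ({p | Function.Surjective (Φ p.1) ∧ Φ p.1 ∘ₗ p.2 = 0} ∩ O)) := by
  rw [isOpen_iff_forall_mem_open]
  rintro _ ⟨⟨x, m⟩, ⟨⟨hx, hm⟩, hO'⟩, rfl⟩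
  obtain ⟨s, hs⟩ := exists_comp_eq_id hx
  set X := Set.univ ∩ {y : E | IsUnit (Φ y ∘ₗ s : Module.End k H)}
  have hΦ (Y : Set E) : RegularOn k (fun y => Φ y) Y := RegularOn.linear Φ Y
  have hX : IsOpen X :=
    RegularOn.isOpen_inter_isUnit ((hΦ _).linearMap_comp (RegularOn.const s _)) isOpen_univ
  have hsection : RegularOn k (fun y => (y, projKer s (Φ y) ∘ₗ m)) X :=
    (regularOn_id X).prodMk
      (((hΦ X).projKer fun _ hy => hy.2).linearMap_comp (RegularOn.const m X))
  refine ⟨_, ?_, hsection.continuousOn.isOpen_inter_preimage hX hO, ⟨trivial, ?_⟩, ?_⟩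
  · rintro y ⟨hy, hyO⟩
    refine ⟨(y, projKer s (Φ y) ∘ₗ m), ⟨⟨surjective_of_isUnit_comp hy.2, ?_⟩, hyO⟩, rfl⟩
    rw [← LinearMap.comp_assoc, comp_projKer hy.2, LinearMap.zero_comp]
  · rw [Set.mem_ofPred_eq, hs]
    exact isUnit_one
  · rwa [Set.mem_preimage, projKer_comp_of_comp_eq_zero hm]

end KernelFamily

theorem isOpen_coinduced_subtype_iff {X Y : Type*} [TopologicalSpace X] {p : X → Prop}
    (hp : IsOpen {x | p x}) (π : {x // p x} → Y) {U : Set Y} :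
    (TopologicalSpace.coinduced π inferInstance).IsOpen U ↔
      IsOpen {x | ∃ hx : p x, π ⟨x, hx⟩ ∈ U} := by
  refine (hp.isOpenEmbedding_subtypeVal.isOpen_iff_image_isOpen (s := π ⁻¹' U)).trans ?_
  simp only [Set.image, Set.mem_preimage, Subtype.exists, exists_and_right, exists_eq_right,
    Set.mem_ofPred_eq]

section HomProd

/-- The Zariski topology of `Hom(E, F) × N`, of which the topology of `GrProd` is a quotient. As a
local instance it takes precedence over the (coarser) product topology. -/
local instance homProdTopology {k E F N : Type*} [Field k] [AddCommGroup E] [Module k E]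
    [AddCommGroup F] [Module k F] [AddCommGroup N] [Module k N] :
    TopologicalSpace ((E →ₗ[k] F) × N) :=
  zariski k _

local instance zariskiSpace_homProd {k E F N : Type*} [Field k] [AddCommGroup E] [Module k E]
    [AddCommGroup F] [Module k F] [AddCommGroup N] [Module k N] :
    ZariskiSpace k ((E →ₗ[k] F) × N) :=
  ⟨rfl⟩

section Grassmannian

variable {k : Type*} [Field k] {E : Type*} [AddCommGroup E] [Module k E] {f : ℕ}
  {N : Type*} [AddCommGroup N] [Module k N]

theorem isOpen_gr_iff {U : Set (Module.Grassmannian k E f)} :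
    IsOpen U ↔
      IsOpen {g : E →ₗ[k] (Fin f → k) | ∃ hg : Function.Surjective g, kerGr g hg ∈ U} := by
  have hsurj := (regularOn_id (k := k) (E := E →ₗ[k] (Fin f → k)) _).isOpen_inter_surjective
    isOpen_univ
  rw [Set.univ_inter] at hsurj
  exact isOpen_coinduced_subtype_iff hsurj _

theorem isOpen_grProd_iff {U : Set (GrProd k E f N)} :
    IsOpen U ↔ IsOpen {p : (E →ₗ[k] (Fin f → k)) × N |
      ∃ hp : Function.Surjective p.1, ⟨kerGr p.1 hp, p.2⟩ ∈ U} := by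
  have hsurj := (regularOn_fst (k := k) (E := E →ₗ[k] (Fin f → k)) (F := N)
    _).isOpen_inter_surjective isOpen_univ
  rw [Set.univ_inter] at hsurj
  exact isOpen_coinduced_subtype_iff hsurj _

theorem isOpen_setOf_pt_mem [TopologicalSpace N] [ZariskiSpace k N] {U : Set N} (hU : IsOpen U) :
    IsOpen {p : GrProd k E f N | p.pt ∈ U} := by
  rw [isOpen_grProd_iff]
  have hsnd : Continuous fun p : (E →ₗ[k] (Fin f → k)) × N => p.2 :=
    continuousOn_univ.1 (regularOn_snd (k := k) _).continuousOn
  simp only [Set.mem_ofPred_eq, exists_prop, and_comm]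
  exact RegularOn.isOpen_inter_surjective (regularOn_fst _) (hU.preimage hsnd)

variable [FiniteDimensional k E]

theorem exists_eq_kerGr (Z : Module.Grassmannian k E f) :
    ∃ (g : E →ₗ[k] (Fin f → k)) (hg : Function.Surjective g), Z = kerGr g hg := by
  have hcodim : codim k Z.toSubmodule = Module.finrank k (Fin f → k) := by
    have hrank := Z.rankAtStalk_eq default
    rw [Module.rankAtStalk_eq_finrank_of_free, Pi.natCast_apply] at hrank
    exact hrank.trans (Module.finrank_fin_fun k).symm
  obtain ⟨g, hg, hgZ⟩ := exists_surjective_ker_eq hcodim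
  exact ⟨g, hg, Module.Grassmannian.ext hgZ.symm⟩

theorem isPreirreducible_gr [Infinite k] :
    IsPreirreducible (Set.univ : Set (Module.Grassmannian k E f)) := by
  rintro U W hU hW ⟨Z, -, hZ⟩ ⟨Z', -, hZ'⟩
  obtain ⟨g, hg, rfl⟩ := exists_eq_kerGr Z
  obtain ⟨g', hg', rfl⟩ := exists_eq_kerGr Z'
  obtain ⟨t, ⟨ht, htU⟩, _, htW⟩ := exists_lineMap_mem_and_mem (k := k) (isOpen_gr_iff.1 hU)
    (isOpen_gr_iff.1 hW) ⟨hg, hZ⟩ ⟨hg', hZ'⟩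
  exact ⟨_, trivial, htU, htW⟩

end Grassmannian

section Locus

variable {k : Type*} [Field k]
  {A B V : Type*} [AddCommGroup A] [Module k A] [AddCommGroup B] [Module k B]
  [AddCommGroup V] [Module k V]
  {f : ℕ} {F G : Type*} [AddCommGroup F] [Module k F] [AddCommGroup G] [Module k G] {X : Set G}

theorem RegularOn.formStar {g : G → A ⊗[k] SymSq k V →ₗ[k] F} (hg : RegularOn k g X) :
    RegularOn k (fun x => formStar (g x)) X :=
  (hg.map (G := A ⊗[k] V →ₗ[k] V →ₗ[k] F) (formStarHom k A V F) :)

theorem RegularOn.one {m : G → B →ₗ[k] A ⊗[k] V} (hm : RegularOn k m X) :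
    RegularOn k (fun x => one (m x)) X :=
  (hm.map (oneHom k A B V) :)

variable [FiniteDimensional k V]

theorem codim_Zstar_kerGr_eq_iff (hV : Module.finrank k V = 4)
    {g : A ⊗[k] SymSq k V →ₗ[k] (Fin f → k)} (hg : Function.Surjective g) :
    codim k (Zstar (kerGr g hg).toSubmodule) = 4 * f ↔ Function.Surjective (formStar g) := by
  rw [← codim_Zstar_ker_eq_iff, hV, Module.finrank_fin_fun]
  rfl

theorem mk_mem_locusQ_iff (hV : Module.finrank k V = 4)
    {g : A ⊗[k] SymSq k V →ₗ[k] (Fin f → k)} (hg : Function.Surjective g)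
    {m : B →ₗ[k] A ⊗[k] V} :
    ⟨kerGr g hg, m⟩ ∈ locusQ k A B V f ↔ Function.Surjective (formStar g) ∧ formStar g ∘ₗ m = 0 :=
  and_congr (codim_Zstar_kerGr_eq_iff hV hg) mem_homStar_ker

variable [FiniteDimensional k A]

theorem isPreirreducible_locusQ [Infinite k] (hV : Module.finrank k V = 4) :
    IsPreirreducible (locusQ k A B V f) := by
  rintro U W hU hW ⟨⟨Z, m⟩, hZ, hZU⟩ ⟨⟨Z', m'⟩, hZ', hZW⟩
  obtain ⟨g, hg, rfl⟩ := exists_eq_kerGr Z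
  obtain ⟨g', hg', rfl⟩ := exists_eq_kerGr Z'
  obtain ⟨p, hp, ⟨hps, hpU⟩, _, hpW⟩ :=
    isPreirreducible_kernelFamily B (formStarHom k A V (Fin f → k)) _ _ (isOpen_grProd_iff.1 hU)
      (isOpen_grProd_iff.1 hW) ⟨(g, m), (mk_mem_locusQ_iff hV hg).1 hZ, hg, hZU⟩
      ⟨(g', m'), (mk_mem_locusQ_iff hV hg').1 hZ', hg', hZW⟩
  exact ⟨_, (mk_mem_locusQ_iff hV hps).2 hp, hpU, hpW⟩

theorem isOpen_setOf_exists_mk_mem_locusQ_inter (hV : Module.finrank k V = 4)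
    {O : Set (GrProd k (A ⊗[k] SymSq k V) f (B →ₗ[k] A ⊗[k] V))} (hO : IsOpen O) :
    IsOpen {Z | ∃ m : B →ₗ[k] A ⊗[k] V, ⟨Z, m⟩ ∈ locusQ k A B V f ∩ O} := by
  rw [isOpen_gr_iff]
  convert isOpen_image_fst_kernelFamily_inter (formStarHom k A V (Fin f → k))
    (isOpen_grProd_iff.1 hO) using 1
  ext g
  constructor
  · rintro ⟨hg, m, hm, hmO⟩
    exact ⟨(g, m), ⟨(mk_mem_locusQ_iff hV hg).1 hm, hg, hmO⟩, rfl⟩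
  · rintro ⟨⟨g, m⟩, ⟨hm, hg, hmO⟩, rfl⟩
    exact ⟨hg, m, (mk_mem_locusQ_iff hV hg).2 hm, hmO⟩

theorem Zof_eq_sub_iff (hV : Module.finrank k V = 4)
    {p : GrProd k (A ⊗[k] SymSq k V) f (B →ₗ[k] A ⊗[k] V)} (hp : p ∈ locusQ k A B V f) :
    Zof p.pt = p.sub.toSubmodule ↔ Module.finrank k (A ⊗[k] SymSq k V) - f ≤
      Module.finrank k (LinearMap.range (one p.pt)) := by
  obtain ⟨Z, m⟩ := p
  obtain ⟨g, hg, rfl⟩ := exists_eq_kerGr Z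
  have hiff := Zof_eq_ker_iff hg ((mk_mem_locusQ_iff hV hg).1 hp).2
  rwa [Module.finrank_fin_fun] at hiff

theorem isOpen_setOf_le_finrank_range_one (r : ℕ) :
    IsOpen {m : B →ₗ[k] A ⊗[k] V | r ≤ Module.finrank k (LinearMap.range (one m))} := by
  simpa only [Set.univ_inter] using
    (regularOn_id (k := k) _).one.isOpen_inter_le_finrank_range isOpen_univ r

theorem exists_isOpen_locusQ_inter (hV : Module.finrank k V = 4) :
    ∃ O : Set (GrProd k (A ⊗[k] SymSq k V) f (B →ₗ[k] A ⊗[k] V)), IsOpen O ∧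
      locusQ k A B V f ∩ O = {p ∈ locusQ k A B V f | Zof p.pt = p.sub.toSubmodule} :=
  ⟨_, isOpen_setOf_pt_mem (isOpen_setOf_le_finrank_range_one _),
    Set.ext fun _ => and_congr_right fun hp => (Zof_eq_sub_iff hV hp).symm⟩

variable [FiniteDimensional k B]

theorem mem_locusPW_iff_exists_locusQ (hV : Module.finrank k V = 4)
    (hab : 5 * Module.finrank k A ≤ 2 * Module.finrank k B) {m : B →ₗ[k] A ⊗[k] V} :
    m ∈ locusPW k A B V f ↔ ∃ Z : Module.Grassmannian k (A ⊗[k] SymSq k V) f,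
      ⟨Z, m⟩ ∈ locusQ k A B V f ∧ Zof m = Z.toSubmodule := by
  have : Nontrivial V := Module.nontrivial_of_finrank_pos (R := k) (by lia)
  rw [mem_locusPW_iff hV hab]
  constructor
  · rintro ⟨g, hgm, hg⟩
    have hgs := surjective_of_formStar_surjective hg
    exact ⟨kerGr g hgs, (mk_mem_locusQ_iff hV hgs).2 ⟨hg, Zof_le_ker.1 hgm.ge⟩, hgm.symm⟩
  · rintro ⟨Z, hZ, hm⟩
    obtain ⟨g, hg, rfl⟩ := exists_eq_kerGr Z
    exact ⟨g, hm.symm, ((mk_mem_locusQ_iff hV hg).1 hZ).1⟩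

theorem isPreirreducible_locusPW [Infinite k] (hV : Module.finrank k V = 4)
    (hab : 5 * Module.finrank k A ≤ 2 * Module.finrank k B) :
    IsPreirreducible (locusPW k A B V f) := by
  rintro U W hU hW ⟨m, hm, hmU⟩ ⟨m', hm', hmW⟩
  obtain ⟨Z, hZ⟩ := (mem_locusPW_iff_exists_locusQ hV hab).1 hm
  obtain ⟨Z', hZ'⟩ := (mem_locusPW_iff_exists_locusQ hV hab).1 hm'
  obtain ⟨O, hO, hOQ⟩ := exists_isOpen_locusQ_inter (k := k) (A := A) (B := B) (f := f) hV
  have hirr := isPreirreducible_inter_of_isOpen (isPreirreducible_locusQ hV) hO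
  rw [hOQ] at hirr
  obtain ⟨⟨Z'', m''⟩, hp, hpU, hpW⟩ := hirr _ _ (isOpen_setOf_pt_mem hU) (isOpen_setOf_pt_mem hW)
    ⟨⟨Z, m⟩, hZ, hmU⟩ ⟨⟨Z', m'⟩, hZ', hmW⟩
  exact ⟨m'', (mem_locusPW_iff_exists_locusQ hV hab).2 ⟨Z'', hp⟩, hpU, hpW⟩

end Locus

section LocalForm

variable {k : Type*} [Field k]
  {E : Type*} [AddCommGroup E] [Module k E] {F : Type*} [AddCommGroup F] [Module k F]
  {G : Type*} [AddCommGroup G] [Module k G] {H : Type*} [AddCommGroup H] [Module k H]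
  {g : E →ₗ[k] H} {j : H →ₗ[k] E}

theorem surjective_of_comp_eq_id (hg : g ∘ₗ j = LinearMap.id) : Function.Surjective g :=
  fun y => ⟨j y, LinearMap.congr_fun hg y⟩

theorem eq_of_ker_le_of_comp_eq_id {g' : E →ₗ[k] H} (hg : g ∘ₗ j = LinearMap.id)
    (hg' : g' ∘ₗ j = LinearMap.id) (h : LinearMap.ker g ≤ LinearMap.ker g') : g' = g := by
  have hj (y) : g (j y) = y := LinearMap.congr_fun hg y
  have hj' (y) : g' (j y) = y := LinearMap.congr_fun hg' y
  ext x
  have hx : x - j (g x) ∈ LinearMap.ker g := by simp [hj]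
  simpa [hj', sub_eq_zero] using h hx

theorem ker_eq_of_finrank_le_codim [FiniteDimensional k E] (hg : Function.Surjective g)
    {Z : Submodule k E} (hZ : LinearMap.ker g ≤ Z) (hcodim : Module.finrank k H ≤ codim k Z) :
    LinearMap.ker g = Z := by
  refine Submodule.eq_of_le_of_finrank_le hZ ?_
  have hker := finrank_add_codim (LinearMap.ker g)
  have hZ := finrank_add_codim Z
  rw [codim_ker_of_surjective hg] at hker
  lia

theorem exists_comp_eq_id_sub {T : F →ₗ[k] E} (hT : LinearMap.ker g ≤ LinearMap.range T)
    (hg : g ∘ₗ j = LinearMap.id) :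
    ∃ c : E →ₗ[k] F, c ∘ₗ j = 0 ∧ T ∘ₗ c = LinearMap.id - j ∘ₗ g := by
  have hj (y) : g (j y) = y := LinearMap.congr_fun hg y
  let π : E →ₗ[k] E := LinearMap.id - j ∘ₗ g
  have hπT (x) : π x ∈ LinearMap.range T := hT (by simp [π, hj])
  obtain ⟨c, hc⟩ := Module.projective_lifting_property T.rangeRestrict (π.codRestrict _ hπT)
    T.surjective_rangeRestrict
  have hTc (x) : T (c x) = π x := congrArg Subtype.val (LinearMap.congr_fun hc x)
  exact ⟨c ∘ₗ π, by ext; simp [π, hj], by ext; simp [hTc, π, hj]⟩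

theorem comp_ringInverse_comp_eq_id {L : Module.End k E} (hL : IsUnit L) (hLj : L ∘ₗ j = j)
    (hg : g ∘ₗ j = LinearMap.id) : (g ∘ₗ Ring.inverse L) ∘ₗ j = LinearMap.id := by
  have hinv : Ring.inverse L ∘ₗ j = j := by
    conv_lhs => rw [← hLj, ← LinearMap.comp_assoc]
    rw [← Module.End.mul_eq_comp, Ring.inverse_mul_cancel _ hL, Module.End.one_eq_id,
      LinearMap.id_comp]
  rw [LinearMap.comp_assoc, hinv, hg]

theorem ker_comp_ringInverse_le {T : F →ₗ[k] E} {c : E →ₗ[k] F}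
    (hL : IsUnit (T ∘ₗ c + j ∘ₗ g : Module.End k E)) :
    LinearMap.ker (g ∘ₗ Ring.inverse (T ∘ₗ c + j ∘ₗ g : Module.End k E)) ≤ LinearMap.range T := by
  intro x hx
  have hx' := LinearMap.congr_fun (Ring.mul_inverse_cancel _ hL) x
  rw [LinearMap.mem_ker, LinearMap.comp_apply] at hx
  rw [Module.End.mul_apply, LinearMap.add_apply, LinearMap.comp_apply, LinearMap.comp_apply, hx,
    map_zero, add_zero] at hx'
  exact ⟨_, hx'⟩

theorem RegularOn.exists_ker_le_range [FiniteDimensional k E] [FiniteDimensional k H]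
    [TopologicalSpace G] [ZariskiSpace k G] {O : Set G} {T : G → F →ₗ[k] E}
    (hT : RegularOn k T O) (hO : IsOpen O) {x₀ : G} (hx₀ : x₀ ∈ O)
    (hker : LinearMap.ker g ≤ LinearMap.range (T x₀)) (hg : g ∘ₗ j = LinearMap.id) :
    ∃ (U : Set G) (γ : G → E →ₗ[k] H), IsOpen U ∧ x₀ ∈ U ∧ RegularOn k γ U ∧ γ x₀ = g ∧
      ∀ x ∈ U, γ x ∘ₗ j = LinearMap.id ∧ LinearMap.ker (γ x) ≤ LinearMap.range (T x) := by
  obtain ⟨c, hcj, hTc⟩ := exists_comp_eq_id_sub hker hg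
  let L (x : G) : Module.End k E := T x ∘ₗ c + j ∘ₗ g
  have hLreg : RegularOn k L O := (hT.map (LinearMap.lcomp k E c)).add (RegularOn.const _ O)
  have hL₀ : L x₀ = 1 := by simp only [L, hTc, sub_add_cancel, Module.End.one_eq_id]
  have hL₀unit : IsUnit (L x₀) := hL₀ ▸ isUnit_one
  have hLj (x : G) : L x ∘ₗ j = j := by
    simp only [L, LinearMap.add_comp, LinearMap.comp_assoc, hcj, hg, LinearMap.comp_zero,
      LinearMap.comp_id, zero_add]
  refine ⟨O ∩ {x | IsUnit (L x)}, fun x => g ∘ₗ Ring.inverse (L x),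
    hLreg.isOpen_inter_isUnit hO, ⟨hx₀, hL₀unit⟩,
    (RegularOn.const g _).linearMap_comp
      ((hLreg.mono Set.inter_subset_left).ringInverse fun x hx => hx.2), ?_, ?_⟩
  · change g ∘ₗ Ring.inverse (L x₀) = g
    rw [hL₀, Ring.inverse_one, Module.End.one_eq_id, LinearMap.comp_id]
  · rintro x ⟨-, hx⟩
    exact ⟨comp_ringInverse_comp_eq_id hx (hLj x) hg, ker_comp_ringInverse_le hx⟩

end LocalForm

section GenericMatrix

variable {k : Type*} [Field k]
  {A B V : Type*} [AddCommGroup A] [Module k A] [AddCommGroup B] [Module k B]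
  [AddCommGroup V] [Module k V] {f : ℕ}
  [FiniteDimensional k A] [FiniteDimensional k V]

theorem exists_ker_le_Zof {m₀ : B →ₗ[k] A ⊗[k] V} {g₀ : A ⊗[k] SymSq k V →ₗ[k] (Fin f → k)}
    (hker : LinearMap.ker g₀ = Zof m₀) {j : (Fin f → k) →ₗ[k] A ⊗[k] SymSq k V}
    (hj : g₀ ∘ₗ j = LinearMap.id) :
    ∃ (U : Set (B →ₗ[k] A ⊗[k] V))
      (γ : (B →ₗ[k] A ⊗[k] V) → A ⊗[k] SymSq k V →ₗ[k] (Fin f → k)),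
      IsOpen U ∧ m₀ ∈ U ∧ RegularOn k γ U ∧ γ m₀ = g₀ ∧
        ∀ m ∈ U, γ m ∘ₗ j = LinearMap.id ∧ LinearMap.ker (γ m) ≤ Zof m :=
  (regularOn_id Set.univ).one.exists_ker_le_range isOpen_univ trivial hker.le hj

variable [FiniteDimensional k B]

theorem mem_locusW_iff_of_ker_le_Zof (hV : Module.finrank k V = 4)
    (hab : 5 * Module.finrank k A ≤ 2 * Module.finrank k B)
    {g : A ⊗[k] SymSq k V →ₗ[k] (Fin f → k)} (hg : Function.Surjective g)
    {m : B →ₗ[k] A ⊗[k] V} (hgm : LinearMap.ker g ≤ Zof m) :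
    m ∈ locusW k A B V f ↔ LinearMap.ker g = Zof m := by
  rw [mem_locusW_iff hV hab]
  refine ⟨fun hm => ker_eq_of_finrank_le_codim hg hgm (by rwa [Module.finrank_fin_fun]),
    fun hm => ?_⟩
  rw [← hm, codim_ker_of_surjective hg, Module.finrank_fin_fun]

theorem mem_locusPW_iff_of_ker_le_Zof (hV : Module.finrank k V = 4)
    (hab : 5 * Module.finrank k A ≤ 2 * Module.finrank k B)
    {g : A ⊗[k] SymSq k V →ₗ[k] (Fin f → k)} (hg : Function.Surjective g)
    {m : B →ₗ[k] A ⊗[k] V} (hgm : LinearMap.ker g ≤ Zof m) :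
    m ∈ locusPW k A B V f ↔ LinearMap.ker g = Zof m ∧ Function.Surjective (formStar g) := by
  refine ⟨fun hm => ?_, fun h => (mem_locusPW_iff hV hab).2 ⟨g, h⟩⟩
  have hker := (mem_locusW_iff_of_ker_le_Zof hV hab hg hgm).1 hm.1
  refine ⟨hker, (codim_Zstar_kerGr_eq_iff hV hg).1 ?_⟩
  rw [show (kerGr g hg).toSubmodule = Zof m from hker]
  exact hm.2.2

theorem exists_isOpen_locusPW_eq (hV : Module.finrank k V = 4)
    (hab : 5 * Module.finrank k A ≤ 2 * Module.finrank k B) :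
    ∃ U : Set (B →ₗ[k] A ⊗[k] V), IsOpen U ∧ locusPW k A B V f = locusW k A B V f ∩ U := by
  refine ⟨⋃₀ {O | IsOpen O ∧ locusW k A B V f ∩ O ⊆ locusPW k A B V f},
    isOpen_sUnion fun O hO => hO.1, Set.Subset.antisymm ?_ ?_⟩
  · intro m hm
    obtain ⟨Z, hZ, hZm⟩ := (mem_locusPW_iff_exists_locusQ hV hab).1 hm
    obtain ⟨g, hg, rfl⟩ := exists_eq_kerGr Z
    obtain ⟨j, hj⟩ := exists_comp_eq_id hg
    obtain ⟨U, γ, hU, hmU, hγ, hγm, hUγ⟩ := exists_ker_le_Zof hZm.symm hj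
    have hgs : Function.Surjective (formStar g) := ((mk_mem_locusQ_iff hV hg).1 hZ).1
    refine ⟨hm.1, _, ⟨hγ.formStar.isOpen_inter_surjective hU, ?_⟩, hmU, by rwa [← hγm] at hgs⟩
    rintro m' ⟨hm', hm'U, hs⟩
    obtain ⟨hγj, hle⟩ := hUγ m' hm'U
    have hγs := surjective_of_comp_eq_id hγj
    exact (mem_locusPW_iff_of_ker_le_Zof hV hab hγs hle).2
      ⟨(mem_locusW_iff_of_ker_le_Zof hV hab hγs hle).1 hm', hs⟩
  · rintro m ⟨hm, O, ⟨-, hO⟩, hmO⟩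
    exact hO ⟨hm, hmO⟩

theorem generically_Zof_eq_sub (hV : Module.finrank k V = 4)
    (hab : 5 * Module.finrank k A ≤ 2 * Module.finrank k B) (hne : (locusPW k A B V f).Nonempty) :
    Generically (locusQ k A B V f) (fun p => Zof p.pt = p.sub.toSubmodule) := by
  obtain ⟨m, hm⟩ := hne
  obtain ⟨Z, hZ⟩ := (mem_locusPW_iff_exists_locusQ hV hab).1 hm
  obtain ⟨O, hO, hOQ⟩ := exists_isOpen_locusQ_inter (k := k) (A := A) (B := B) (f := f) hV
  exact ⟨O, hO, hOQ ▸ ⟨_, hZ⟩, fun p hp => (hOQ.subset hp).2⟩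

theorem generically_locusQ_of_locusPW (hV : Module.finrank k V = 4)
    (hab : 5 * Module.finrank k A ≤ 2 * Module.finrank k B)
    {P : Submodule k (A ⊗[k] SymSq k V) → (B →ₗ[k] A ⊗[k] V) → Prop}
    (hP : Generically (locusPW k A B V f) fun m => P (Zof m) m) :
    Generically (locusQ k A B V f) fun p => P p.sub.toSubmodule p.pt := by
  obtain ⟨U, hU, ⟨m, hm, hmU⟩, h⟩ := hP
  obtain ⟨Z, hZ⟩ := (mem_locusPW_iff_exists_locusQ hV hab).1 hm
  obtain ⟨O, hO, hOQ⟩ := exists_isOpen_locusQ_inter (k := k) (A := A) (B := B) (f := f) hV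
  refine ⟨_, hO.inter (isOpen_setOf_pt_mem hU), ⟨⟨Z, m⟩, hZ.1, (hOQ.superset hZ).2, hmU⟩, ?_⟩
  rintro p ⟨hp, hpO, hpU⟩
  have hpZ := hOQ.subset ⟨hp, hpO⟩
  rw [← hpZ.2]
  exact h _ ⟨(mem_locusPW_iff_exists_locusQ hV hab).2 ⟨p.sub, hpZ⟩, hpU⟩

theorem RegularOn.isOpen_setOf_mk_kerGr_mem {E N : Type*} [AddCommGroup E] [Module k E]
    [AddCommGroup N] [Module k N] [TopologicalSpace N] [ZariskiSpace k N]
    {W : Set N} {γ : N → E →ₗ[k] (Fin f → k)} (hγ : RegularOn k γ W) (hW : IsOpen W)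
    {O : Set (GrProd k E f N)} (hO : IsOpen O) :
    IsOpen {n | n ∈ W ∧ ∃ hs : Function.Surjective (γ n), ⟨kerGr (γ n) hs, n⟩ ∈ O} :=
  (hγ.prodMk (regularOn_id W)).continuousOn.isOpen_inter_preimage hW (isOpen_grProd_iff.1 hO)

theorem generically_locusPW_of_locusQ [Infinite k] (hV : Module.finrank k V = 4)
    (hab : 5 * Module.finrank k A ≤ 2 * Module.finrank k B) (hne : (locusPW k A B V f).Nonempty)
    {P : Submodule k (A ⊗[k] SymSq k V) → (B →ₗ[k] A ⊗[k] V) → Prop}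
    (hP : Generically (locusQ k A B V f) fun p => P p.sub.toSubmodule p.pt) :
    Generically (locusPW k A B V f) fun m => P (Zof m) m := by
  obtain ⟨U, hU, hUne, h⟩ := hP
  obtain ⟨O, hO, hOne, hOeq⟩ := generically_Zof_eq_sub hV hab hne
  obtain ⟨⟨Z, m⟩, hp, hpU, hpO⟩ := isPreirreducible_locusQ hV U O hU hO hUne hOne
  have hmZ : Zof m = Z.toSubmodule := hOeq ⟨Z, m⟩ ⟨hp, hpO⟩
  obtain ⟨g, hg, rfl⟩ := exists_eq_kerGr Z
  obtain ⟨j, hj⟩ := exists_comp_eq_id hg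
  obtain ⟨W, γ, hW, hmW, hγ, hγm, hWγ⟩ := exists_ker_le_Zof (m₀ := m) (g₀ := g) hmZ.symm hj
  have hmPW : m ∈ locusPW k A B V f := (mem_locusPW_iff_exists_locusQ hV hab).2 ⟨_, hp, hmZ⟩
  have hopen := hγ.isOpen_setOf_mk_kerGr_mem hW hU
  refine ⟨_, hopen, ⟨m, hmPW, hmW, ?_⟩, ?_⟩
  · subst hγm
    exact ⟨hg, hpU⟩
  · rintro m' ⟨hm', hm'W, hs, hm'U⟩
    obtain ⟨hker, hstar⟩ := (mem_locusPW_iff_of_ker_le_Zof hV hab hs (hWγ m' hm'W).2).1 hm'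
    rw [← hker]
    exact h _ ⟨(mk_mem_locusQ_iff hV hs).2 ⟨hstar, Zof_le_ker.1 hker.ge⟩, hm'U⟩

theorem generically_codim_Zstar (hV : Module.finrank k V = 4)
    (hab : 5 * Module.finrank k A ≤ 2 * Module.finrank k B) (hne : (locusPW k A B V f).Nonempty) :
    Generically (Set.univ : Set (Module.Grassmannian k (A ⊗[k] SymSq k V) f))
      (fun Z => codim k (Zstar Z.toSubmodule) = 4 * f) := by
  obtain ⟨m, hm⟩ := hne
  obtain ⟨Z, hZ, -⟩ := (mem_locusPW_iff_exists_locusQ hV hab).1 hm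
  exact ⟨_, isOpen_setOf_exists_mk_mem_locusQ_inter (B := B) hV isOpen_univ,
    ⟨Z, trivial, m, hZ, trivial⟩, fun Z ⟨_, _, hm, _⟩ => hm.1⟩

theorem generically_generically_homStar (hV : Module.finrank k V = 4)
    (hab : 5 * Module.finrank k A ≤ 2 * Module.finrank k B) (hne : (locusPW k A B V f).Nonempty) :
    Generically (Set.univ : Set (Module.Grassmannian k (A ⊗[k] SymSq k V) f))
      (fun Z => Generically (homStar B Z.toSubmodule)
        (fun m => m ∈ locusPW k A B V f ∧ Zof m = Z.toSubmodule)) := by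
  obtain ⟨m, hm⟩ := hne
  obtain ⟨Z, hZ, hZm⟩ := (mem_locusPW_iff_exists_locusQ hV hab).1 hm
  have hopen := isOpen_setOf_le_finrank_range_one (k := k) (A := A) (B := B) (V := V)
    (Module.finrank k (A ⊗[k] SymSq k V) - f)
  refine ⟨_, isOpen_setOf_exists_mk_mem_locusQ_inter hV (isOpen_setOf_pt_mem hopen),
    ⟨Z, trivial, m, hZ, (Zof_eq_sub_iff hV hZ).1 hZm⟩, ?_⟩
  rintro Z ⟨-, m, hm, hrank⟩
  refine ⟨_, hopen, ⟨m, hm.2, hrank⟩, ?_⟩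
  rintro m' ⟨hm', hrank'⟩
  have hQ : ⟨Z, m'⟩ ∈ locusQ k A B V f := ⟨hm.1, hm'⟩
  have hZm' : Zof m' = Z.toSubmodule := (Zof_eq_sub_iff hV hQ).2 hrank'
  exact ⟨(mem_locusPW_iff_exists_locusQ hV hab).2 ⟨Z, hQ, hZm'⟩, hZm'⟩

end GenericMatrix

section Dimension

theorem topologicalKrullDim_eq_of_invOn {X Y : Type*} [TopologicalSpace X] [TopologicalSpace Y]
    {S : Set X} {T : Set Y} {φ : X → Y} {ψ : Y → X} (hφ : ContinuousOn φ S)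
    (hψ : ContinuousOn ψ T) (hST : Set.MapsTo φ S T) (hTS : Set.MapsTo ψ T S)
    (h : Set.InvOn ψ φ S T) : topologicalKrullDim S = topologicalKrullDim T := by
  let e : S ≃ₜ T :=
    { toFun := hST.restrict φ S T
      invFun := hTS.restrict ψ T S
      left_inv := fun x => Subtype.ext (h.1 x.2)
      right_inv := fun y => Subtype.ext (h.2 y.2)
      continuous_toFun := hφ.mapsToRestrict hST
      continuous_invFun := hψ.mapsToRestrict hTS }
  exact IsHomeomorph.topologicalKrullDim_eq e e.isHomeomorph

theorem topologicalKrullDim_eq_of_forall_mem_open {X : Type*} [TopologicalSpace X] {S : Set X}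
    {d : ℕ} (hne : S.Nonempty)
    (h : ∀ x ∈ S, ∃ U : Set X, IsOpen U ∧ x ∈ U ∧ topologicalKrullDim ↥(S ∩ U) = d) :
    topologicalKrullDim S = d := by
  refine le_antisymm (topologicalKrullDim_le_of_forall_mem_open fun x => ?_) ?_
  · obtain ⟨U, hU, hxU, hd⟩ := h x x.2
    refine ⟨Subtype.val ⁻¹' U, hU.preimage continuous_subtype_val, hxU, hd ▸ ?_⟩
    have hincl : ∀ y : (Subtype.val ⁻¹' U : Set S), y.1.1 ∈ S ∩ U := fun y => ⟨y.1.2, y.2⟩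
    exact ((Topology.IsInducing.subtypeVal.comp Topology.IsInducing.subtypeVal).codRestrict
      hincl).topologicalKrullDim_le
  · obtain ⟨x, hx⟩ := hne
    obtain ⟨U, -, -, hd⟩ := h x hx
    rw [← hd]
    exact (Topology.IsEmbedding.inclusion Set.inter_subset_left).isInducing.topologicalKrullDim_le

theorem topologicalKrullDim_inter_eq_finrank (k : Type*) [Field k] [Infinite k] {X V : Type*}
    [TopologicalSpace X] [AddCommGroup V] [Module k V] [TopologicalSpace V] [ZariskiSpace k V]
    [FiniteDimensional k V] {S U : Set X} {O : Set V} {φ : X → V} {ψ : V → X} (hU : IsOpen U)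
    (hO : IsOpen O) (hφ : ContinuousOn φ S) (hψ : ContinuousOn ψ O) (hSO : Set.MapsTo φ S O)
    (hOS : Set.MapsTo ψ O S) (h : Set.InvOn ψ φ S O) (hne : (S ∩ U).Nonempty) :
    topologicalKrullDim ↥(S ∩ U) = Module.finrank k V := by
  have hmaps : Set.MapsTo φ (S ∩ U) (O ∩ ψ ⁻¹' U) := fun x hx =>
    ⟨hSO hx.1, Set.mem_preimage.2 ((h.1 hx.1).symm ▸ hx.2)⟩
  rw [topologicalKrullDim_eq_of_invOn (hφ.mono Set.inter_subset_left)
    (hψ.mono Set.inter_subset_left) hmaps (fun y hy => ⟨hOS hy.1, hy.2⟩)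
    (h.mono Set.inter_subset_left Set.inter_subset_left)]
  exact topologicalKrullDim_of_isOpen k (hψ.isOpen_inter_preimage hO hU)
    ((hne.image φ).mono hmaps.image_subset)

theorem topologicalKrullDim_eq_finrank (k : Type*) [Field k] [Infinite k] (E : Type*)
    [AddCommGroup E] [Module k E] [TopologicalSpace E] [ZariskiSpace k E] [FiniteDimensional k E] :
    topologicalKrullDim E = Module.finrank k E := by
  rw [← topologicalKrullDim_of_isOpen k (isOpen_univ (X := E)) Set.univ_nonempty]
  exact (IsHomeomorph.topologicalKrullDim_eq _ (Homeomorph.Set.univ E).isHomeomorph).symm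

section KernelFamily

variable {k : Type*} [Field k] [Infinite k]
  {E : Type*} [AddCommGroup E] [Module k E] {F : Type*} [AddCommGroup F] [Module k F]
  {H : Type*} [AddCommGroup H] [Module k H] {B : Type*} [AddCommGroup B] [Module k B]
  [FiniteDimensional k E] [FiniteDimensional k F] [FiniteDimensional k H] [FiniteDimensional k B]
  [TopologicalSpace (E × (B →ₗ[k] F))] [ZariskiSpace k (E × (B →ₗ[k] F))]

theorem topologicalKrullDim_kernelFamily_inter {Ψ : E → F →ₗ[k] H} {s : H →ₗ[k] F}
    (hΨ : RegularOn k Ψ Set.univ) {U : Set (E × (B →ₗ[k] F))} (hU : IsOpen U)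
    (hne : ({p | IsUnit (Ψ p.1 ∘ₗ s : Module.End k H) ∧ Ψ p.1 ∘ₗ p.2 = 0} ∩ U).Nonempty) :
    topologicalKrullDim
        ↥({p | IsUnit (Ψ p.1 ∘ₗ s : Module.End k H) ∧ Ψ p.1 ∘ₗ p.2 = 0} ∩ U) =
      (Module.finrank k E +
        Module.finrank k B * (Module.finrank k F - Module.finrank k H) : ℕ) := by
  obtain ⟨p₀, ⟨hp₀, -⟩, -⟩ := id hne
  obtain ⟨κ, hκ, hκK, hκs⟩ := exists_subtype_comp_eq_projKer hp₀
  generalize hK : LinearMap.ker (Ψ p₀.1) = K at κ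
  rw [← finrank_ker_of_surjective (surjective_of_isUnit_comp hp₀), hK, ← Module.finrank_linearMap,
    ← Module.finrank_prod]
  let : TopologicalSpace (E × (B →ₗ[k] K)) := zariski k _
  have : ZariskiSpace k (E × (B →ₗ[k] K)) := ⟨rfl⟩
  have hΨfst (Y : Set (E × (B →ₗ[k] K))) : RegularOn k (fun p => Ψ p.1) Y :=
    hΨ.comp (regularOn_fst Y) (Set.mapsTo_univ _ _)
  let O := Set.univ ∩ {p : E × (B →ₗ[k] K) | IsUnit (Ψ p.1 ∘ₗ s : Module.End k H)}
  have hO : IsOpen O :=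
    ((hΨfst _).linearMap_comp (RegularOn.const s _)).isOpen_inter_isUnit isOpen_univ
  have hψ : RegularOn k (fun p => (p.1, projKer s (Ψ p.1) ∘ₗ K.subtype ∘ₗ p.2)) O :=
    (regularOn_fst O).prodMk (((hΨfst O).projKer fun _ hp => hp.2).linearMap_comp
      ((RegularOn.const K.subtype O).linearMap_comp (regularOn_snd O)))
  have hφ (X : Set (E × (B →ₗ[k] F))) : RegularOn k (fun p => (p.1, κ ∘ₗ p.2)) X :=
    (regularOn_fst X).prodMk ((RegularOn.const κ X).linearMap_comp (regularOn_snd X))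
  refine topologicalKrullDim_inter_eq_finrank k hU hO (hφ _).continuousOn hψ.continuousOn
    (fun p hp => ⟨trivial, hp.1⟩) (fun p hp => ⟨hp.2, ?_⟩)
    ⟨fun p hp => Prod.ext rfl ?_, fun p _ => Prod.ext rfl ?_⟩ hne
  · rw [← LinearMap.comp_assoc, comp_projKer hp.2, LinearMap.zero_comp]
  · change projKer s (Ψ p.1) ∘ₗ K.subtype ∘ₗ κ ∘ₗ p.2 = p.2
    rw [← LinearMap.comp_assoc p.2 κ, hκ, ← LinearMap.comp_assoc,
      comp_projKer_of_comp_eq_zero (projKer_comp hp.1), projKer_comp_of_comp_eq_zero hp.2]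
  · change κ ∘ₗ projKer s (Ψ p.1) ∘ₗ K.subtype ∘ₗ p.2 = p.2
    rw [← LinearMap.comp_assoc, comp_projKer_of_comp_eq_zero hκs, ← LinearMap.comp_assoc, hκK,
      LinearMap.id_comp]

end KernelFamily

section LocusPW

variable {k : Type*} [Field k]
  {A B V : Type*} [AddCommGroup A] [Module k A] [AddCommGroup B] [Module k B]
  [AddCommGroup V] [Module k V] {f : ℕ}
  [FiniteDimensional k A] [FiniteDimensional k B] [FiniteDimensional k V]

theorem mem_locusPW_iff_formStar_comp_eq_zero (hV : Module.finrank k V = 4)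
    (hab : 5 * Module.finrank k A ≤ 2 * Module.finrank k B)
    {g : A ⊗[k] SymSq k V →ₗ[k] (Fin f → k)} (hg : Function.Surjective g)
    (hstar : Function.Surjective (formStar g)) {m : B →ₗ[k] A ⊗[k] V}
    (hgm : LinearMap.ker g ≤ Zof m) :
    m ∈ locusPW k A B V f ↔ formStar g ∘ₗ m = 0 := by
  rw [mem_locusPW_iff_of_ker_le_Zof hV hab hg hgm, ← Zof_le_ker]
  exact ⟨fun h => h.1.ge, fun h => ⟨le_antisymm hgm h, hstar⟩⟩

theorem topologicalKrullDim_locusPW_inter (hV : Module.finrank k V = 4)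
    (hab : 5 * Module.finrank k A ≤ 2 * Module.finrank k B)
    {g₀ : A ⊗[k] SymSq k V →ₗ[k] (Fin f → k)} {j : (Fin f → k) →ₗ[k] A ⊗[k] SymSq k V}
    (hj : g₀ ∘ₗ j = LinearMap.id) {π : A ⊗[k] SymSq k V →ₗ[k] LinearMap.ker g₀}
    (hπ : (LinearMap.ker g₀).subtype ∘ₗ π = projKer j g₀)
    (hπK : π ∘ₗ (LinearMap.ker g₀).subtype = LinearMap.id) (hπj : π ∘ₗ j = 0)
    {s : (V →ₗ[k] (Fin f → k)) →ₗ[k] A ⊗[k] V} {U : Set (B →ₗ[k] A ⊗[k] V)}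
    {γ : (B →ₗ[k] A ⊗[k] V) → A ⊗[k] SymSq k V →ₗ[k] (Fin f → k)} (hγ : RegularOn k γ U)
    (hU : ∀ m ∈ U, γ m ∘ₗ j = LinearMap.id ∧ LinearMap.ker (γ m) ≤ Zof m)
    (hs : ∀ m ∈ U, IsUnit (formStar (γ m) ∘ₗ s : Module.End k (V →ₗ[k] (Fin f → k)))) :
    topologicalKrullDim ↥(locusPW k A B V f ∩ U) =
      topologicalKrullDim ↥({p : (LinearMap.ker g₀ →ₗ[k] (Fin f → k)) × (B →ₗ[k] A ⊗[k] V) |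
        IsUnit (formStar (g₀ + p.1 ∘ₗ π) ∘ₗ s : Module.End k (V →ₗ[k] (Fin f → k))) ∧
          formStar (g₀ + p.1 ∘ₗ π) ∘ₗ p.2 = 0} ∩ {p | p.2 ∈ U}) := by
  have hγeq (m) (hm : m ∈ U) : g₀ + ((γ m - g₀) ∘ₗ (LinearMap.ker g₀).subtype) ∘ₗ π = γ m :=
    add_sub_comp_comp_eq hπ ((hU m hm).1.trans hj.symm)
  have hmem (m) (hm : m ∈ U) : m ∈ locusPW k A B V f ↔ formStar (γ m) ∘ₗ m = 0 :=
    mem_locusPW_iff_formStar_comp_eq_zero hV hab (surjective_of_comp_eq_id (hU m hm).1)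
      (surjective_of_isUnit_comp (hs m hm)) (hU m hm).2
  have heq (d : LinearMap.ker g₀ →ₗ[k] (Fin f → k)) (m) (hm : m ∈ U)
      (h : formStar (g₀ + d ∘ₗ π) ∘ₗ m = 0) : g₀ + d ∘ₗ π = γ m :=
    eq_of_ker_le_of_comp_eq_id (hU m hm).1
      (by rw [LinearMap.add_comp, LinearMap.comp_assoc, hπj, LinearMap.comp_zero, add_zero, hj])
      ((hU m hm).2.trans (Zof_le_ker.2 h))
  have hφ : RegularOn k (fun m => ((γ m - g₀) ∘ₗ (LinearMap.ker g₀).subtype, m)) U :=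
    ((hγ.sub (RegularOn.const g₀ U)).linearMap_comp (RegularOn.const _ U)).prodMk (regularOn_id U)
  refine topologicalKrullDim_eq_of_invOn (hφ.mono Set.inter_subset_right).continuousOn
    (regularOn_snd (k := k) _).continuousOn (fun m hm => ⟨?_, hm.2⟩) (fun p hp => ⟨?_, hp.2⟩)
    ⟨fun m _ => rfl, fun p hp => Prod.ext ?_ rfl⟩
  · rw [Set.mem_ofPred_eq, hγeq m hm.2]
    exact ⟨hs m hm.2, (hmem m hm.2).1 hm.1⟩
  · exact (hmem _ hp.2).2 (heq _ _ hp.2 hp.1.2 ▸ hp.1.2)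
  · change (γ p.2 - g₀) ∘ₗ (LinearMap.ker g₀).subtype = p.1
    rw [← heq _ _ hp.2 hp.1.2, add_sub_cancel_left, LinearMap.comp_assoc, hπK, LinearMap.comp_id]

theorem exists_isOpen_topologicalKrullDim_locusPW_inter [Infinite k] (hV : Module.finrank k V = 4)
    (hab : 5 * Module.finrank k A ≤ 2 * Module.finrank k B) {m₀ : B →ₗ[k] A ⊗[k] V}
    (hm₀ : m₀ ∈ locusPW k A B V f) :
    ∃ U : Set (B →ₗ[k] A ⊗[k] V), IsOpen U ∧ m₀ ∈ U ∧
      topologicalKrullDim ↥(locusPW k A B V f ∩ U) =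
        ((10 * Module.finrank k A - f) * f +
          Module.finrank k B * (4 * Module.finrank k A - 4 * f) : ℕ) := by
  have : Nontrivial V := Module.nontrivial_of_finrank_pos (R := k) (by lia)
  obtain ⟨g₀, hker, hstar⟩ := (mem_locusPW_iff hV hab).1 hm₀
  have hg₀ := surjective_of_formStar_surjective hstar
  obtain ⟨j, hj⟩ := exists_comp_eq_id hg₀
  obtain ⟨s, hs⟩ := exists_comp_eq_id hstar
  obtain ⟨W, γ, hW, hmW, hγ, hγm, hWγ⟩ := exists_ker_le_Zof hker hj
  obtain ⟨π, hπ, hπK, hπj⟩ := exists_subtype_comp_eq_projKer (s := j) (Φ := g₀)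
    (by rw [hj]; exact isUnit_one)
  let U := W ∩ {m | IsUnit (formStar (γ m) ∘ₗ s : Module.End k (V →ₗ[k] (Fin f → k)))}
  have hU : IsOpen U := (hγ.formStar.linearMap_comp (RegularOn.const s W)).isOpen_inter_isUnit hW
  have hm₀U : m₀ ∈ U := ⟨hmW, by rw [Set.mem_ofPred_eq, hγm, hs]; exact isUnit_one⟩
  have hΨ : RegularOn k (fun d => formStar (g₀ + d ∘ₗ π)) Set.univ :=
    ((RegularOn.const g₀ _).add ((regularOn_id _).linearMap_comp (RegularOn.const π _))).formStar
  have hsndU : IsOpen {p : (LinearMap.ker g₀ →ₗ[k] (Fin f → k)) × (B →ₗ[k] A ⊗[k] V) | p.2 ∈ U} :=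
    hU.preimage (continuousOn_univ.1 (regularOn_snd (k := k) Set.univ).continuousOn)
  have hfinrank : Module.finrank k (LinearMap.ker g₀) = 10 * Module.finrank k A - f := by
    rw [finrank_ker_of_surjective hg₀, Module.finrank_fin_fun, Module.finrank_tensorProduct,
      finrank_symSq, hV, mul_comm]
    rfl
  refine ⟨U, hU, hm₀U, ?_⟩
  rw [topologicalKrullDim_locusPW_inter (U := U) (s := s) hV hab hj hπ hπK hπj
      (hγ.mono Set.inter_subset_left) (fun m hm => hWγ m hm.1) fun m hm => hm.2,
    topologicalKrullDim_kernelFamily_inter hΨ hsndU ⟨(0, m₀), ⟨?_, ?_⟩, hm₀U⟩]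
  · simp only [Module.finrank_linearMap, Module.finrank_tensorProduct, Module.finrank_fin_fun, hV,
      hfinrank, mul_comm _ 4]
  · rw [LinearMap.zero_comp, add_zero, hs]
    exact isUnit_one
  · rw [LinearMap.zero_comp, add_zero, ← Zof_le_ker, hker]

theorem le_finrank_of_mem_locusPW (hV : Module.finrank k V = 4)
    (hab : 5 * Module.finrank k A ≤ 2 * Module.finrank k B) {m : B →ₗ[k] A ⊗[k] V}
    (hm : m ∈ locusPW k A B V f) : f ≤ Module.finrank k A := by
  obtain ⟨g, -, hstar⟩ := (mem_locusPW_iff hV hab).1 hm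
  have hle := LinearMap.finrank_le_finrank_of_surjective hstar
  rw [Module.finrank_linearMap, Module.finrank_tensorProduct, hV, Module.finrank_fin_fun] at hle
  lia

theorem expectedDim_add_expectedCodim {a b f : ℕ} (hfa : f ≤ a) (hab : 5 * a ≤ 2 * b) :
    (10 * a - f) * f + b * (4 * a - 4 * f) + f * (4 * b - 10 * a + f) = b * (a * 4) := by
  zify [show f ≤ 10 * a by lia, show 4 * f ≤ 4 * a by lia, show 10 * a ≤ 4 * b by lia]
  ring

theorem hasCodim_locusPW [Infinite k] (hV : Module.finrank k V = 4)
    (hab : 5 * Module.finrank k A ≤ 2 * Module.finrank k B)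
    (hne : (locusPW k A B V f).Nonempty) :
    HasCodim (locusPW k A B V f)
      (f * (4 * Module.finrank k B - 10 * Module.finrank k A + f)) := by
  refine ⟨_, _, topologicalKrullDim_eq_of_forall_mem_open hne fun m hm =>
    exists_isOpen_topologicalKrullDim_locusPW_inter hV hab hm,
    topologicalKrullDim_eq_finrank k _, ?_⟩
  obtain ⟨m, hm⟩ := hne
  rw [Module.finrank_linearMap, Module.finrank_tensorProduct, hV]
  exact expectedDim_add_expectedCodim (le_finrank_of_mem_locusPW hV hab hm) hab

end LocusPW

end Dimension

end HomProd

end Steiner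

end

theorem proposition4p1_general {k : Type*} [Field k] [Infinite k]
    {A B V : Type*} [AddCommGroup A] [Module k A] [FiniteDimensional k A]
    [AddCommGroup B] [Module k B] [FiniteDimensional k B]
    [AddCommGroup V] [Module k V] [FiniteDimensional k V]
    (a b f : ℕ) (hA : Module.finrank k A = a) (hB : Module.finrank k B = b)
    (hV : Module.finrank k V = 4) (hf : 1 ≤ f) (hab : 5 * a ≤ 2 * b) (haf : 5 * f < 2 * a) :
    (∃ U : Set (B →ₗ[k] A ⊗[k] V), IsOpen U ∧
      Steiner.locusPW k A B V f = Steiner.locusW k A B V f ∩ U) ∧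
    (Steiner.locusPW k A B V f).Nonempty ∧
    IsIrreducible (Steiner.locusPW k A B V f) ∧
    Steiner.HasCodim (Steiner.locusPW k A B V f) (f * (4 * b - 10 * a + f)) ∧
    IsIrreducible (Set.univ :
      Set (Module.Grassmannian k (A ⊗[k] Steiner.SymSq k V) f)) ∧
    Steiner.Generically
      (Set.univ : Set (Module.Grassmannian k (A ⊗[k] Steiner.SymSq k V) f))
      (fun Z => Steiner.codim k (Steiner.Zstar Z.toSubmodule) = 4 * f) ∧
    IsIrreducible (Steiner.locusQ k A B V f) ∧
    (∀ P : Submodule k (A ⊗[k] Steiner.SymSq k V) →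
        (B →ₗ[k] A ⊗[k] V) → Prop,
      Steiner.Generically (Steiner.locusPW k A B V f) (fun m => P (Steiner.Zof m) m) ↔
        Steiner.Generically (Steiner.locusQ k A B V f) (fun p => P p.sub.toSubmodule p.pt)) ∧
    Steiner.Generically (Steiner.locusQ k A B V f)
      (fun p => Steiner.Zof p.pt = p.sub.toSubmodule) ∧
    Steiner.Generically
      (Set.univ : Set (Module.Grassmannian k (A ⊗[k] Steiner.SymSq k V) f))
      (fun Z => Steiner.Generically (Steiner.homStar B Z.toSubmodule)
        (fun m => m ∈ Steiner.locusPW k A B V f ∧ Steiner.Zof m = Z.toSubmodule)) := by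
  subst hA hB
  obtain ⟨m, g, hg, hm⟩ := Steiner.HasApolarSystem.exists_Zof_eq_ker (A := A) (B := B) hV
    (Steiner.HasApolarSystem.of_le_of_lt hf hab haf)
  have hPW : m ∈ Steiner.locusPW k A B V f := (Steiner.mem_locusPW_iff hV hab).2 ⟨g, hm.symm, hg⟩
  have hne : (Steiner.locusPW k A B V f).Nonempty := ⟨m, hPW⟩
  obtain ⟨Z, hZ, -⟩ := (Steiner.mem_locusPW_iff_exists_locusQ hV hab).1 hPW
  exact ⟨Steiner.exists_isOpen_locusPW_eq hV hab, hne,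
    ⟨hne, Steiner.isPreirreducible_locusPW hV hab⟩, Steiner.hasCodim_locusPW hV hab hne,
    ⟨⟨Z, trivial⟩, Steiner.isPreirreducible_gr⟩, Steiner.generically_codim_Zstar hV hab hne,
    ⟨⟨⟨Z, m⟩, hZ⟩, Steiner.isPreirreducible_locusQ hV⟩,
    fun P => ⟨Steiner.generically_locusQ_of_locusPW hV hab,
      Steiner.generically_locusPW_of_locusQ hV hab hne⟩,
    Steiner.generically_Zof_eq_sub hV hab hne,
    Steiner.generically_generically_homStar hV hab hne⟩

theorem proposition4p1 {k : Type*} [Field k] [IsAlgClosed k] [CharZero k]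
    {A B V : Type*} [AddCommGroup A] [Module k A] [FiniteDimensional k A]
    [AddCommGroup B] [Module k B] [FiniteDimensional k B]
    [AddCommGroup V] [Module k V] [FiniteDimensional k V]
    (a b f : ℕ) (hA : Module.finrank k A = a) (hB : Module.finrank k B = b)
    (hV : Module.finrank k V = 4) (hf : 1 ≤ f) (hab : 5 * a ≤ 2 * b) (haf : 5 * f < 2 * a) :
    -- `𝒫𝒲` is open in `𝒲`
    (∃ U : Set (B →ₗ[k] A ⊗[k] V), IsOpen U ∧
      Steiner.locusPW k A B V f = Steiner.locusW k A B V f ∩ U) ∧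
    -- `𝒫𝒲` is non-empty and irreducible
    (Steiner.locusPW k A B V f).Nonempty ∧
    IsIrreducible (Steiner.locusPW k A B V f) ∧
    -- `𝒫𝒲` has the expected codimension
    Steiner.HasCodim (Steiner.locusPW k A B V f) (f * (4 * b - 10 * a + f)) ∧
    -- the Grassmannian is irreducible, and `Z*` has codimension `4f` for the generic `Z`
    IsIrreducible (Set.univ :
      Set (Module.Grassmannian k (A ⊗[k] Steiner.SymSq k V) f)) ∧
    Steiner.Generically
      (Set.univ : Set (Module.Grassmannian k (A ⊗[k] Steiner.SymSq k V) f))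
      (fun Z => Steiner.codim k (Steiner.Zstar Z.toSubmodule) = 4 * f) ∧
    -- the pairs `(Z, m)` with `m : B → Z*` form an irreducible variety, and the generic matrix `μ`
    -- of `𝒫𝒲`, with the subspace `Im μ(1)`, is the generic such pair
    IsIrreducible (Steiner.locusQ k A B V f) ∧
    (∀ P : Submodule k (A ⊗[k] Steiner.SymSq k V) →
        (B →ₗ[k] A ⊗[k] V) → Prop,
      Steiner.Generically (Steiner.locusPW k A B V f) (fun m => P (Steiner.Zof m) m) ↔
        Steiner.Generically (Steiner.locusQ k A B V f) (fun p => P p.sub.toSubmodule p.pt)) ∧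
    -- for the generic pair `(Z, m)`, the image of `m(1)` is `Z`
    Steiner.Generically (Steiner.locusQ k A B V f)
      (fun p => Steiner.Zof p.pt = p.sub.toSubmodule) ∧
    -- fibrewise: for the generic `Z`, the generic `m : B → Z*` is in `𝒫𝒲`, and `Im m(1) = Z`
    Steiner.Generically
      (Set.univ : Set (Module.Grassmannian k (A ⊗[k] Steiner.SymSq k V) f))
      (fun Z => Steiner.Generically (Steiner.homStar B Z.toSubmodule)
        (fun m => m ∈ Steiner.locusPW k A B V f ∧ Steiner.Zof m = Z.toSubmodule)) :=
  proposition4p1_general a b f hA hB hV hf hab haf
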